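/- **Conventions.** All graphs are finite, simple and undirected. A bipartite graph $G=(A,B,E)$ comes with its two sides $A,B$, which partition $V(G)$; $|G|=|V(G)|$. A first-order transduction $\mathsf T=(k,\Lambda,\psi)$ consists of $k\in\mathbb N$, a finite set $\Lambda$ of unary predicates and a first-order formula $\psi(x,y)$ over $\{\mathsf{adj},\mathsf{cp}\}\cup\Lambda$. A graph $H$ belongs to $\mathsf T(G)$ if it is isomorphic to an induced subgraph of $\psi(G^*)$, where $G^*$ is some marking, by the predicates of $\Lambda$, of the disjoint union of $k$ copies of $G$ with $\mathsf{cp}$ relating the copies of the same vertex, and $\psi(G^*)$ is the graph on the vertices of $G^*$ with edges defined by $\psi$ (symmetrized, without loops). The half-graph of order $t$ has vertices $u_1,\dots,u_t,v_1,\dots,v_t$ and edges $u_iv_j$ for $i\le j$. A class $\mathscr C$ is *monadically stable* if there is no transduction $\mathsf T$ such that every half-graph belongs to $\bigcup_{G\in\mathscr C}\mathsf T(G)$. It has *linear neighborhood complexity* if there is $c$ such that $|\{N_G(v)\cap S : v\in V(G)\}|\le c|S|$ for every $G\in\mathscr C$ and every nonempty $S\subseteq V(G)$. Running time is measured on a word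 RAM with unit-cost instructions and words of $O(\log |G|)$ bits; graphs are given by the indicator of $A$ and the adjacency matrix, with $V(G)=\{0,\dots,|G|-1\}$. **Lemma.** Let $\mathscr C$ be a monadically stable class of bipartite graphs with linear neighborhood complexity. Then there exist a number $k^*\in\mathbb N$, an algorithm with running time $\mathcal O(|G|^4)$, and a first-order formula $\mathsf{leader}(x,y)$ over adjacency, the two side predicates and finitely many further unary predicates, all depending only on $\mathscr C$, such that for every $G=(A,B,E)\in\mathscr C$ without isolated vertices the algorithm computes a partition $\mathcal F=\{P_1,\dots,P_{|\mathcal F|}\}$ of $B$ into nonempty parts and vertices $\ell_1,\dots,\ell_{|\mathcal F|}\in A$ with the following properties: 1. $P_i\subseteq N_G(\ell_i)$ for every $i\in\{1,\dots,|\mathcal F|\}$; 2. every $v\in A$ has a neighbor in at most $k^*$ parts, i.e. $|\{P\in\mathcal F : N_G(v)\cap P\neq\emptyset\}|\le k^*$; 3. there is a graph $G^+$ obtained from $G$ by marking vertices with the unary predicates such that for all $u\in A$ and $v\in B$: $G^+\models\mathsf{leader}(u,v)$ if and only if $u=\ell_i$ and $v\in P_i$ for some $i\in\{1,\dots,|\mathcal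 F|\}$. -/

import Mathlib

/-! ### Finite bipartite graphs with named sides -/

/-- A finite bipartite graph `G = (A, B, E)` on the vertex set `{0, …, n - 1}`. The left side `A` is
`left`; the right side `B` is its complement. -/
structure BipGraph where
  /-- The number `|G|` of vertices. -/
  n : ℕ
  graph : SimpleGraph (Fin n)
  left : Set (Fin n)
  isBipartiteWith : graph.IsBipartiteWith left leftᶜ

/-- The right side `B` of `G = (A, B, E)`. -/
def BipGraph.right (G : BipGraph) : Set (Fin G.n) := G.leftᶜ

/-- `G` has no isolated vertices. -/
def BipGraph.NoIsolated (G : BipGraph) : Prop := ∀ v, ∃ u, G.graph.Adj v u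

/-! ### Transductions and monadic stability -/

/-- Relation symbols for coloured copies of graphs: adjacency, the copy relation, and `m` unary
predicates. -/
inductive CopyRel (m : ℕ) : ℕ → Type
  | adj : CopyRel m 2
  | cp : CopyRel m 2
  | color (c : Fin m) : CopyRel m 1

/-- The signature `{adj, cp} ∪ Λ` with `|Λ| = m`. -/
abbrev copyLang (m : ℕ) : FirstOrder.Language.{0, 0} := ⟨fun _ => Empty, CopyRel m⟩

/-- The `k`-copy of the graph `G` marked with the unary predicates `M`, as a structure on
`V × Fin k`. -/
@[reducible]
def copyStructure {V : Type} (G : SimpleGraph V) (k : ℕ) {m : ℕ} (M : Fin m → Set (V × Fin k)) :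
    (copyLang m).Structure (V × Fin k) where
  funMap f := Empty.elim f
  RelMap
    | .adj => fun x => (x 0).2 = (x 1).2 ∧ G.Adj (x 0).1 (x 1).1
    | .cp => fun x => (x 0).1 = (x 1).1
    | .color c => fun x => x 0 ∈ M c

/-- A first-order transduction `(k, Λ, ψ)`: the number of copies, the number of unary predicates,
and a formula `ψ(x, y)` with the two free variables `0` and `1`. -/
structure Transduction where
  copies : ℕ
  colors : ℕ
  formula : (copyLang colors).Formula (Fin 2)

/-- The graph `ψ(G*)` on the vertices of the marked `k`-copy `G*`. Graphs are simple and
undirected, so loops are dropped and `ψ` is symmetrised. -/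
def Transduction.image (T : Transduction) {V : Type} (G : SimpleGraph V)
    (M : Fin T.colors → Set (V × Fin T.copies)) : SimpleGraph (V × Fin T.copies) :=
  SimpleGraph.fromRel fun u v =>
    @FirstOrder.Language.Formula.Realize (copyLang T.colors) (V × Fin T.copies)
      (copyStructure G T.copies M) (Fin 2) T.formula ![u, v]

/-- `T.Transduces G H` means `H ∈ T(G)`: for some marking `M`, the graph `H` is (isomorphic to) an
induced subgraph of `ψ(G*)`. -/
def Transduction.Transduces (T : Transduction) {V W : Type} (G : SimpleGraph V)
    (H : SimpleGraph W) : Prop :=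
  ∃ M : Fin T.colors → Set (V × Fin T.copies), Nonempty (H ↪g T.image G M)

/-- The half-graph of order `t`: vertices `u_i = inl i`, `v_j = inr j`, edges `u_i v_j` for
`i ≤ j`. -/
def halfGraph (t : ℕ) : SimpleGraph (Fin t ⊕ Fin t) :=
  SimpleGraph.fromRel fun x y =>
    match x, y with
    | .inl i, .inr j => i ≤ j
    | _, _ => False

/-- The class of all half-graphs is not transducible from `C`. -/
def MonadicallyStable (C : Set BipGraph) : Prop :=
  ¬ ∃ T : Transduction, ∀ t : ℕ, ∃ G ∈ C, T.Transduces G.graph (halfGraph t)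

/-- `C` has linear neighborhood complexity. -/
def LinearNeighborhoodComplexity (C : Set BipGraph) : Prop :=
  ∃ c : ℕ, ∀ G ∈ C, ∀ S : Set (Fin G.n), S.Nonempty →
    (Set.range fun v => G.graph.neighborSet v ∩ S).ncard ≤ c * S.ncard

/-! ### Unary colorings of bipartite graphs -/

/-- Relation symbols for coloured bipartite graphs: adjacency, the two sides, and `m` further unary
predicates. -/
inductive BipRel (m : ℕ) : ℕ → Type
  | adj : BipRel m 2
  | left : BipRel m 1
  | right : BipRel m 1
  | color (c : Fin m) : BipRel m 1

/-- The signature `{adj, L, R}` extended by `m` unary predicates. -/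
abbrev bipLang (m : ℕ) : FirstOrder.Language.{0, 0} := ⟨fun _ => Empty, BipRel m⟩

/-- The unary coloring of `G` in which the vertices of `M c` are marked with the `c`-th
predicate. -/
@[reducible]
def BipGraph.coloring (G : BipGraph) {m : ℕ} (M : Fin m → Set (Fin G.n)) :
    (bipLang m).Structure (Fin G.n) where
  funMap f := Empty.elim f
  RelMap
    | .adj => fun x => G.graph.Adj (x 0) (x 1)
    | .left => fun x => x 0 ∈ G.left
    | .right => fun x => x 0 ∈ G.right
    | .color c => fun x => x 0 ∈ M c

/-- The coloring of `G` by `M` satisfies `φ(u, v)`. -/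
def BipGraph.Satisfies (G : BipGraph) {m : ℕ} (M : Fin m → Set (Fin G.n))
    (φ : (bipLang m).Formula (Fin 2)) (u v : Fin G.n) : Prop :=
  @FirstOrder.Language.Formula.Realize (bipLang m) (Fin G.n) (G.coloring M) (Fin 2) φ ![u, v]

/-! ### Random access machine with a step count -/

namespace RAM

/-- Programs of a random access machine. `d`, `a`, `b` are names of registers. -/
inductive Prog
  | skip
  /-- `reg d := k` -/
  | const (d k : ℕ)
  /-- `reg d := reg a + reg b` -/
  | add (d a b : ℕ)
  /-- `reg d := reg a - reg b` (truncated at zero) -/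
  | sub (d a b : ℕ)
  /-- `reg d := reg a * reg b` -/
  | mul (d a b : ℕ)
  /-- `reg d := mem (reg a)` -/
  | load (d a : ℕ)
  /-- `mem (reg a) := reg b` -/
  | store (a b : ℕ)
  /-- first `p`, then `q` -/
  | seq (p q : Prog)
  /-- if `reg a < reg b` then `p` else `q` -/
  | ite (a b : ℕ) (p q : Prog)
  /-- while `reg a < reg b` do `p` -/
  | loop (a b : ℕ) (p : Prog)

/-- The contents of the registers and of the memory cells. -/
@[ext]
structure State where
  reg : ℕ → ℕ
  mem : ℕ → ℕ

/-- Write `x` into register `d`. -/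
def State.setReg (s : State) (d x : ℕ) : State := ⟨Function.update s.reg d x, s.mem⟩

/-- Write `x` into memory cell `i`. -/
def State.setMem (s : State) (i x : ℕ) : State := ⟨s.reg, Function.update s.mem i x⟩

/-- `Exec W p s t s'`: on a machine whose words hold the numbers `0, …, W`, the program `p` started
in state `s` halts after exactly `t` steps in state `s'`. Every elementary instruction and every
evaluation of a branch or loop condition is one step. An arithmetic overflow aborts the
computation: there is no execution in that case. -/
inductive Exec (W : ℕ) : Prog → State → ℕ → State → Prop
  | skip (s : State) : Exec W .skip s 1 s
  | const (s : State) (d k : ℕ) (h : k ≤ W) : Exec W (.const d k) s 1 (s.setReg d k)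
  | add (s : State) (d a b : ℕ) (h : s.reg a + s.reg b ≤ W) :
      Exec W (.add d a b) s 1 (s.setReg d (s.reg a + s.reg b))
  | sub (s : State) (d a b : ℕ) : Exec W (.sub d a b) s 1 (s.setReg d (s.reg a - s.reg b))
  | mul (s : State) (d a b : ℕ) (h : s.reg a * s.reg b ≤ W) :
      Exec W (.mul d a b) s 1 (s.setReg d (s.reg a * s.reg b))
  | load (s : State) (d a : ℕ) : Exec W (.load d a) s 1 (s.setReg d (s.mem (s.reg a)))
  | store (s : State) (a b : ℕ) : Exec W (.store a b) s 1 (s.setMem (s.reg a) (s.reg b))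
  | seq {p q : Prog} {s s' s'' : State} {t t' : ℕ} (hp : Exec W p s t s')
      (hq : Exec W q s' t' s'') : Exec W (.seq p q) s (t + t') s''
  | ite_true {a b : ℕ} {p q : Prog} {s s' : State} {t : ℕ} (h : s.reg a < s.reg b)
      (hp : Exec W p s t s') : Exec W (.ite a b p q) s (t + 1) s'
  | ite_false {a b : ℕ} {p q : Prog} {s s' : State} {t : ℕ} (h : ¬ s.reg a < s.reg b)
      (hq : Exec W q s t s') : Exec W (.ite a b p q) s (t + 1) s'
  | loop_true {a b : ℕ} {p : Prog} {s s' s'' : State} {t t' : ℕ} (h : s.reg a < s.reg b)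
      (hp : Exec W p s t s') (hl : Exec W (.loop a b p) s' t' s'') :
      Exec W (.loop a b p) s (t + t' + 1) s''
  | loop_false {a b : ℕ} {p : Prog} {s : State} (h : ¬ s.reg a < s.reg b) :
      Exec W (.loop a b p) s 1 s

end RAM

open Classical in
/-- The input state for `G`: register `0` holds `n = |G|`, the cells `0, …, n - 1` hold the
indicator of the left side, the next `n²` cells hold the adjacency matrix row by row, and everything
else is `0`. -/
noncomputable def BipGraph.inputState (G : BipGraph) : RAM.State where
  reg r := if r = 0 then G.n else 0
  mem i :=
    if (∃ v : Fin G.n, i = v ∧ v ∈ G.left) ∨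
        (∃ u v : Fin G.n, i = G.n + u * G.n + v ∧ G.graph.Adj u v) then 1 else 0

/-- The state `s` presents the family `P_0, …, P_{p - 1}` of parts of the right side of `G`
with leaders `ℓ_0, …, ℓ_{p - 1}`: register `0` holds `p`, the cell `v` holds the index of the part
of `v` for every `v` of the right side, and the cell `n + i` holds `ℓ_i`. -/
def BipGraph.IsOutput (G : BipGraph) {p : ℕ} (P : Fin p → Set (Fin G.n)) (ℓ : Fin p → Fin G.n)
    (s : RAM.State) : Prop :=
  s.reg 0 = p ∧ (∀ v ∈ G.right, ∀ i : Fin p, v ∈ P i ↔ s.mem v = i) ∧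
    ∀ i : Fin p, s.mem (G.n + i) = ℓ i

/-- `P_0, …, P_{p - 1}` is a partition of the right side of `G` into nonempty parts. -/
structure BipGraph.IsRightPartition (G : BipGraph) {p : ℕ} (P : Fin p → Set (Fin G.n)) : Prop where
  nonempty : ∀ i, (P i).Nonempty
  disjoint : ∀ i j, i ≠ j → Disjoint (P i) (P j)
  iUnion_eq : ⋃ i, P i = G.right

/-!
# Partitions of a side of a bipartite graph into parts with leaders

Only two consequences of the hypotheses are used: linear neighborhood complexity, and a bound on the
length of half-graphs that are induced subgraphs (which the identity transduction would produce).

*Elimination.* The left side `A` is eliminated vertex by vertex. If `X` is the set of vertices left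
and `|X| ≥ 2`, then the next vertex `a` to go has a near-twin `a'` in `X`: the vertices adjacent to
exactly one of `a`, `a'` have at most `K` traces on `X`. Near-twins exist by Haussler's packing
lemma (`separation_le`), since on representatives of the traces on `X`, which are at most `c |X|` many,
the neighborhoods form a set system with linearly many traces. The leader of `b` in the right side
is the neighbor of `b` that is removed last, and the parts are the sets of vertices with a common
leader.

*Few parts at a vertex.* Let `U ⊆ N(a₀)` consist of vertices with distinct leaders. Two vertices of
`U` with leaders in `X` have distinct traces on `X`, and a vertex whose leader is not in `X` has no
neighbor in `X` at all. Hence passing from a vertex to its near-twin changes the trace on `U` in at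
most `K` places. The chain of near-twins that starts at `a₀` leads from all of `U` to a trace with
at most one element, so some trace on the way splits `U`, and likewise every large subset of `U`,
into two large pieces (`IsElimination.exists_card_mem_Icc`). If `U` is large, this gives a high binary
tree of splits (`IsElimination.splits`), and such a tree contains a long half-graph
(`Splits.exists_ladder`). So the size of `U` is bounded by a constant `k`.

*The formula.* A leader touched by `N(a)` other than `a` is removed later than `a`, and there are at
most `k` of them, so `k + 1` colors suffice to give `a` a color different from those of all these
leaders (`exists_greedy_coloring`). With each part colored like its leader, `u` is the leader of `v`
if and only if `u` is a leader, `u` and `v` are adjacent, and they have the same color.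

*The algorithm.* A round of the elimination marks the least vertex of every trace on `X`, which
takes cubic time, and then counts, for every pair of vertices of `X`, the marked vertices adjacent
to exactly one of them, again in cubic time. The neighbors of the vertex removed are labelled with it,
and later labels overwrite earlier ones, so that in the end every label names the leader.
-/

/-! ### A packing lemma for set systems with linearly many traces -/

/-- The number of edges of the one-inclusion graph on the subsets of `S`, where the edge between `q`
and `insert x q` is weighted by the smaller one of the weights of its ends. -/
def edgeWeight {β : Type*} [DecidableEq β] (S : Finset β) (w : Finset β → ℕ) : ℕ :=
  ∑ x ∈ S, ∑ q ∈ (S.erase x).powerset, min (w q) (w (insert x q))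

/-- The one-inclusion graph of a set system that shatters no set of size `d` has at most `d` times
as many edges as vertices; this is the weighted form. Removing the point `x` replaces `w` by the
larger and by the smaller one of the weights of `q` and `insert x q`. The support of the smaller one
does not even shatter a set of size `d - 1`, which pays for the edges in direction `x`. -/
theorem edgeWeight_le {β : Type*} [DecidableEq β] (S : Finset β) :
    ∀ (w : Finset β → ℕ) (d : ℕ),
      (∀ T ⊆ S, T.card = d → ¬ ∀ R ⊆ T, ∃ q ⊆ S, q ∩ T = R ∧ w q ≠ 0) →
        edgeWeight S w ≤ d * ∑ q ∈ S.powerset, w q := by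
  induction S using Finset.induction_on with
  | empty => intro w d _; simp [edgeWeight]
  | insert x S hx ih =>
    intro w d hw
    rcases d with _ | d
    · have h0 : ∀ q ⊆ insert x S, w q = 0 := by
        intro q hq
        by_contra hne
        refine hw ∅ (by simp) (by simp) fun R hR => ⟨q, hq, ?_, hne⟩
        simp [Finset.subset_empty.mp hR]
      rw [edgeWeight, Finset.sum_eq_zero, Nat.zero_mul]
      intro y hy
      refine Finset.sum_eq_zero fun q hq => ?_
      rw [h0 q ((Finset.mem_powerset.mp hq).trans (Finset.erase_subset _ _)), Nat.zero_min]
    · have h1 := ih (fun q => max (w q) (w (insert x q))) (d + 1) (by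
        intro T hT hcard hall
        refine hw T (hT.trans (Finset.subset_insert _ _)) hcard fun R hR => ?_
        obtain ⟨q, hq, hqT, hne⟩ := hall R hR
        by_cases h : w q = 0
        · refine ⟨insert x q, Finset.insert_subset_insert _ hq, ?_, fun h' => hne (by simp [h, h'])⟩
          rw [Finset.insert_inter_of_notMem (fun h => hx (hT h)), hqT]
        · exact ⟨q, hq.trans (Finset.subset_insert _ _), hqT, h⟩)
      have h2 := ih (fun q => min (w q) (w (insert x q))) d (by
        intro T hT hcard hall
        have hxT : x ∉ T := fun h => hx (hT h)
        refine hw (insert x T) (Finset.insert_subset_insert _ hT)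
          (by rw [Finset.card_insert_of_notMem hxT, hcard]) fun R hR => ?_
        obtain ⟨q, hq, hqT, hne⟩ := hall (R.erase x) (by
          intro y hy
          have := hR (Finset.mem_of_mem_erase hy)
          exact (Finset.mem_insert.mp this).resolve_left (Finset.ne_of_mem_erase hy))
        have hxq : x ∉ q := fun h => hx (hq h)
        by_cases hxR : x ∈ R
        · refine ⟨insert x q, Finset.insert_subset_insert _ hq, ?_, by grind⟩
          rw [← Finset.insert_inter_distrib, hqT, Finset.insert_erase hxR]
        · refine ⟨q, hq.trans (Finset.subset_insert _ _), ?_, by grind⟩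
          rw [Finset.inter_insert_of_notMem hxq, hqT, Finset.erase_eq_of_notMem hxR])
      have hdir : edgeWeight (insert x S) w ≤ (∑ q ∈ S.powerset, min (w q) (w (insert x q))) +
          (edgeWeight S (fun q => max (w q) (w (insert x q))) +
            edgeWeight S (fun q => min (w q) (w (insert x q)))) := by
        rw [edgeWeight, Finset.sum_insert hx, Finset.erase_insert hx, edgeWeight, edgeWeight,
          ← Finset.sum_add_distrib]
        refine Nat.add_le_add_left (Finset.sum_le_sum fun y hy => ?_) _
        have hxy : x ≠ y := fun h => hx (h ▸ hy)
        rw [Finset.erase_insert_of_ne hxy, Finset.sum_powerset_insert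
          (fun h => hx (Finset.mem_of_mem_erase h)), ← Finset.sum_add_distrib,
          ← Finset.sum_add_distrib]
        refine Finset.sum_le_sum fun q _ => ?_
        rw [Finset.insert_comm y x q]
        omega
      have hsum : (∑ q ∈ S.powerset, max (w q) (w (insert x q))) +
          ∑ q ∈ S.powerset, min (w q) (w (insert x q)) = ∑ q ∈ (insert x S).powerset, w q := by
        rw [Finset.sum_powerset_insert hx, ← Finset.sum_add_distrib, ← Finset.sum_add_distrib]
        exact Finset.sum_congr rfl fun q _ => by omega
      rw [← hsum]
      nlinarith

/-- Choosing a set of size `s + 1` and one of its points is the same as choosing a set of size `s`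
and a further point. -/
theorem sum_powersetCard_succ {β : Type*} [DecidableEq β] (Y : Finset β) (s : ℕ)
    (f : β → Finset β → ℕ) :
    ∑ S ∈ Y.powersetCard (s + 1), ∑ x ∈ S, f x (S.erase x) =
      ∑ S ∈ Y.powersetCard s, ∑ x ∈ Y \ S, f x S := by
  rw [Finset.sum_sigma', Finset.sum_sigma']
  refine Finset.sum_bij' (fun p _ => ⟨p.1.erase p.2, p.2⟩) (fun p _ => ⟨insert p.2 p.1, p.2⟩)
    ?_ ?_ ?_ ?_ ?_
  · rintro ⟨S, x⟩ h
    simp only [Finset.mem_sigma, Finset.mem_powersetCard] at h ⊢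
    obtain ⟨⟨hS, hc⟩, hx⟩ := h
    refine ⟨⟨(Finset.erase_subset _ _).trans hS, ?_⟩, ?_⟩
    · rw [Finset.card_erase_of_mem hx, hc]; rfl
    · simp [hS hx]
  · rintro ⟨S, x⟩ h
    simp only [Finset.mem_sigma, Finset.mem_powersetCard, Finset.mem_sdiff] at h ⊢
    obtain ⟨⟨hS, hc⟩, hx, hxS⟩ := h
    refine ⟨⟨Finset.insert_subset hx hS, ?_⟩, Finset.mem_insert_self _ _⟩
    rw [Finset.card_insert_of_notMem hxS, hc]
  · rintro ⟨S, x⟩ h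
    simp only [Finset.mem_sigma] at h
    simp [Finset.insert_erase h.2]
  · rintro ⟨S, x⟩ h
    simp only [Finset.mem_sigma, Finset.mem_sdiff] at h
    simp [Finset.erase_insert h.2.2]
  · rintro ⟨S, x⟩ _; rfl

/-- In a class `Q` of pairwise `δ`-separated sets, the smaller sides of the splits of `Q` by the
points of `Z` have total size at least `δ (|Q| - 1) / 2`. -/
theorem separated_le_sum_min {α β : Type*} [DecidableEq α] [DecidableEq β] (Q : Finset α)
    (Z : Finset β) (N : α → Finset β) (δ : ℕ)
    (hδ : ∀ a ∈ Q, ∀ b ∈ Q, a ≠ b → δ ≤ (symmDiff (N a) (N b) ∩ Z).card) :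
    δ * (Q.card - 1) ≤
      2 * ∑ x ∈ Z, min (Q.filter fun a => x ∉ N a).card (Q.filter fun a => x ∈ N a).card := by
  rcases Q.eq_empty_or_nonempty with rfl | hQ
  · simp
  have hpos : 0 < Q.card := hQ.card_pos
  -- Each pair of members of `Q` is separated by at least `δ` points.
  have hpairs : δ * (Q.card * (Q.card - 1)) ≤
      ∑ p ∈ Q.offDiag, (symmDiff (N p.1) (N p.2) ∩ Z).card := by
    have : Q.card * (Q.card - 1) = Q.offDiag.card := by
      rw [Finset.offDiag_card, Nat.mul_sub_one]
    rw [this, mul_comm, ← smul_eq_mul]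
    refine Finset.card_nsmul_le_sum _ _ _ fun p hp => ?_
    rw [Finset.mem_offDiag] at hp
    exact hδ _ hp.1 _ hp.2.1 hp.2.2
  have hcount : ∑ p ∈ Q.offDiag, (symmDiff (N p.1) (N p.2) ∩ Z).card =
      ∑ x ∈ Z, (Q.offDiag.filter fun p => x ∈ symmDiff (N p.1) (N p.2)).card := by
    simp only [Finset.card_filter]
    rw [Finset.sum_congr rfl (g := fun p => ∑ x ∈ Z,
      if x ∈ symmDiff (N p.1) (N p.2) then 1 else 0)]
    · rw [Finset.sum_comm]
    · intro p _
      rw [← Finset.card_filter, Finset.inter_comm, ← Finset.filter_mem_eq_inter]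
  have hsplit : ∀ x ∈ Z, (Q.offDiag.filter fun p => x ∈ symmDiff (N p.1) (N p.2)).card ≤
      2 * (min (Q.filter fun a => x ∉ N a).card (Q.filter fun a => x ∈ N a).card * Q.card) := by
    intro x _
    set m₀ := (Q.filter fun a => x ∉ N a) with hm₀
    set m₁ := (Q.filter fun a => x ∈ N a) with hm₁
    have hle : (Q.offDiag.filter fun p => x ∈ symmDiff (N p.1) (N p.2)) ⊆
        (m₀ ×ˢ m₁) ∪ (m₁ ×ˢ m₀) := by
      rintro ⟨a, b⟩ h
      simp only [Finset.mem_filter, Finset.mem_offDiag, Finset.mem_symmDiff, Finset.mem_union,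
        Finset.mem_product, hm₀, hm₁] at h ⊢
      tauto
    have h1 := (Finset.card_le_card hle).trans (Finset.card_union_le _ _)
    rw [Finset.card_product, Finset.card_product] at h1
    have h2 : m₀.card ≤ Q.card := Finset.card_filter_le _ _
    have h3 : m₁.card ≤ Q.card := Finset.card_filter_le _ _
    rcases le_total m₀.card m₁.card with h | h
    · rw [min_eq_left h]; nlinarith
    · rw [min_eq_right h]; nlinarith
  have hfin : δ * (Q.card - 1) * Q.card ≤ (2 * ∑ x ∈ Z,
      min (Q.filter fun a => x ∉ N a).card (Q.filter fun a => x ∈ N a).card) * Q.card := by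
    calc δ * (Q.card - 1) * Q.card = δ * (Q.card * (Q.card - 1)) := by ring
      _ ≤ _ := hpairs.trans hcount.le
      _ ≤ _ := Finset.sum_le_sum hsplit
      _ = _ := by rw [← Finset.mul_sum, ← Finset.sum_mul]; ring
  exact Nat.le_of_mul_le_mul_right hfin hpos

/-- Haussler's packing lemma for set systems with linearly many traces: if `X` indexes sets that are
pairwise `δ`-separated on a ground set `Y` of size `O(|X|)`, then `δ` is bounded. Counted are the
splits of the classes of a random sample `S` by a further random point, from above by
`edgeWeight_le` and from below by the separation. -/
theorem separation_le {α β : Type*} [DecidableEq α] [DecidableEq β] (X : Finset α) (Y : Finset β)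
    (N : α → Finset β) (c d δ : ℕ) (hd : c * d < 2 ^ d) (hd0 : 0 < d)
    (htrace : ∀ S ⊆ Y, S.Nonempty → (X.image fun a => N a ∩ S).card ≤ c * S.card)
    (hYX : Y.card ≤ c * X.card) (hX : 2 ≤ X.card)
    (hδ : ∀ a ∈ X, ∀ b ∈ X, a ≠ b → δ ≤ (symmDiff (N a) (N b) ∩ Y).card) :
    δ ≤ 16 * d * c ^ 2 := by
  rcases Nat.eq_zero_or_pos δ with rfl | hδ0
  · simp
  have hinj : Set.InjOn (fun a => N a ∩ Y) X := by
    intro a ha b hb hab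
    by_contra hne
    have h1 := hδ a ha b hb hne
    have : symmDiff (N a) (N b) ∩ Y = ∅ := by
      have hab' : N a ∩ Y = N b ∩ Y := hab
      ext y
      have := Finset.ext_iff.mp hab' y
      simp only [Finset.mem_inter, Finset.mem_symmDiff, Finset.notMem_empty, iff_false] at this ⊢
      tauto
    rw [this, Finset.card_empty] at h1
    omega
  have hY : Y.Nonempty := by
    obtain ⟨a, ha, b, hb, hne⟩ := Finset.one_lt_card.mp hX
    have h1 := hδ a ha b hb hne
    by_contra h
    rw [Finset.not_nonempty_iff_eq_empty.mp h] at h1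
    simp at h1
    omega
  have hXY : X.card ≤ c * Y.card := by
    rw [← Finset.card_image_of_injOn hinj]
    exact htrace Y subset_rfl hY
  have hc : 0 < c := by
    rcases Nat.eq_zero_or_pos c with rfl | h
    · rw [Nat.zero_mul] at hXY; omega
    · exact h
  -- The sample size is such that a sample has at most `|X| / 2` traces.
  set s := X.card / (2 * c) with hs
  have hs1 : 2 * c * s ≤ X.card := Nat.mul_div_le _ _
  have hs2 : X.card < 2 * c * (s + 1) := Nat.lt_mul_div_succ _ (by omega)
  have hsY : s ≤ Y.card := by
    by_contra h
    push Not at h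
    nlinarith [Nat.mul_le_mul_left c h.le]
  have hhalf : ∀ S ∈ Y.powersetCard s, 2 * (X.image fun a => N a ∩ S).card ≤ X.card := by
    intro S hS
    rw [Finset.mem_powersetCard] at hS
    rcases S.eq_empty_or_nonempty with rfl | hne
    · have : (X.image fun a => N a ∩ (∅ : Finset β)).card ≤ 1 := by
        refine Finset.card_le_one.mpr fun u hu v hv => ?_
        simp only [Finset.inter_empty, Finset.mem_image] at hu hv
        obtain ⟨_, _, rfl⟩ := hu
        obtain ⟨_, _, rfl⟩ := hv
        rfl
      omega
    · have := htrace S hS.1 hne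
      rw [hS.2] at this
      nlinarith
  -- `wt S q` is the number of members of the system with trace `q` on `S`.
  set wt : Finset β → Finset β → ℕ := fun S q => (X.filter fun a => N a ∩ S = q).card with hwt
  have hmass : ∀ S, ∑ q ∈ S.powerset, wt S q = X.card := by
    intro S
    rw [Finset.card_eq_sum_card_fiberwise (f := fun a => N a ∩ S) (t := S.powerset)]
    intro a _
    simp
  have hupper : ∀ S ∈ Y.powersetCard (s + 1), edgeWeight S (wt S) ≤ d * X.card := by
    intro S hS
    rw [Finset.mem_powersetCard] at hS
    rw [← hmass S]
    refine edgeWeight_le S _ d fun T hT hcard hall => ?_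
    have hsub : T.powerset ⊆ X.image fun a => N a ∩ T := by
      intro R hR
      obtain ⟨q, -, hqT, hne⟩ := hall R (Finset.mem_powerset.mp hR)
      obtain ⟨a, ha⟩ := Finset.card_ne_zero.mp hne
      rw [Finset.mem_filter] at ha
      refine Finset.mem_image.mpr ⟨a, ha.1, ?_⟩
      rw [← hqT, ← ha.2, Finset.inter_assoc, Finset.inter_eq_right.mpr hT]
    have h1 := Finset.card_le_card hsub
    rw [Finset.card_powerset, hcard] at h1
    have h2 := htrace T (hT.trans hS.1) (Finset.card_pos.mp (by omega))
    rw [hcard] at h2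
    omega
  have hlower : ∀ S ∈ Y.powersetCard s, δ * X.card ≤ 4 * ∑ x ∈ Y \ S, ∑ q ∈ S.powerset,
      min (wt (insert x S) q) (wt (insert x S) (insert x q)) := by
    intro S hS
    have hclass : ∀ q ∈ S.powerset, δ * (wt S q - 1) ≤ 2 * ∑ x ∈ Y \ S,
        min (wt (insert x S) q) (wt (insert x S) (insert x q)) := by
      intro q hq
      have hqS := Finset.mem_powerset.mp hq
      have h := separated_le_sum_min (X.filter fun a => N a ∩ S = q) (Y \ S) N δ (by
        intro a ha b hb hne
        rw [Finset.mem_filter] at ha hb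
        refine (hδ a ha.1 b hb.1 hne).trans (Finset.card_le_card fun y hy => ?_)
        have h := Finset.ext_iff.mp (ha.2.trans hb.2.symm) y
        simp only [Finset.mem_inter, Finset.mem_symmDiff, Finset.mem_sdiff] at h hy ⊢
        tauto)
      refine h.trans (Nat.mul_le_mul_left 2 (Finset.sum_le_sum fun x hx => ?_))
      rw [Finset.mem_sdiff] at hx
      have hxq : x ∉ q := fun h => hx.2 (hqS h)
      rw [Finset.filter_filter, Finset.filter_filter]
      refine min_le_min (Finset.card_le_card fun a ha => ?_) (Finset.card_le_card fun a ha => ?_)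
      · rw [Finset.mem_filter] at ha ⊢
        refine ⟨ha.1, ?_⟩
        rw [Finset.inter_insert_of_notMem ha.2.2, ha.2.1]
      · rw [Finset.mem_filter] at ha ⊢
        refine ⟨ha.1, ?_⟩
        rw [Finset.inter_insert_of_mem ha.2.2, ha.2.1]
    have h1 : δ * X.card ≤ ∑ q ∈ S.powerset, δ * (wt S q - 1) +
        δ * (X.image fun a => N a ∩ S).card := by
      rw [← Finset.mul_sum, ← Nat.mul_add]
      refine Nat.mul_le_mul_left δ ?_
      have h2 : (X.image fun a => N a ∩ S).card =
          ∑ q ∈ S.powerset, if q ∈ X.image (fun a => N a ∩ S) then 1 else 0 := by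
        rw [← Finset.sum_filter, ← Finset.card_eq_sum_ones]
        congr 1
        ext q
        simp only [Finset.mem_filter, Finset.mem_powerset, iff_and_self, Finset.mem_image]
        rintro ⟨a, _, rfl⟩
        exact Finset.inter_subset_right
      rw [h2, ← Finset.sum_add_distrib, ← hmass S]
      refine Finset.sum_le_sum fun q _ => ?_
      split_ifs with h
      · omega
      · have : wt S q = 0 := by
          rw [hwt, Finset.card_eq_zero, Finset.filter_eq_empty_iff]
          intro a ha haq
          exact h (Finset.mem_image.mpr ⟨a, ha, haq⟩)
        omega
    have h2 := Finset.sum_le_sum hclass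
    rw [← Finset.mul_sum, ← Finset.mul_sum, Finset.sum_comm] at h2
    have h3 := Nat.mul_le_mul_left δ (hhalf S hS)
    rw [← Finset.mul_sum] at h1
    linarith
  have hchain : Y.card.choose s * (δ * X.card) ≤ 4 * (Y.card.choose (s + 1) * (d * X.card)) := by
    have h1 := Finset.sum_le_sum hlower
    rw [Finset.sum_const, Finset.card_powersetCard, smul_eq_mul, ← Finset.mul_sum,
      ← sum_powersetCard_succ Y s fun x S => ∑ q ∈ S.powerset,
        min (wt (insert x S) q) (wt (insert x S) (insert x q))] at h1
    have h2 := Finset.sum_le_sum hupper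
    rw [Finset.sum_const, Finset.card_powersetCard, smul_eq_mul] at h2
    refine h1.trans (Nat.mul_le_mul_left 4 (le_trans (le_of_eq ?_) h2))
    refine Finset.sum_congr rfl fun S _ => Finset.sum_congr rfl fun x hx => ?_
    rw [Finset.insert_erase hx]
  have hchoose := Nat.choose_succ_right_eq Y.card s
  have hpos : 0 < Y.card.choose s := Nat.choose_pos hsY
  have h5 : δ * (s + 1) ≤ 4 * d * Y.card := by
    have h6 : (Y.card.choose s * X.card) * (δ * (s + 1)) ≤
        (Y.card.choose s * X.card) * (4 * d * Y.card) := by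
      calc (Y.card.choose s * X.card) * (δ * (s + 1))
          = (Y.card.choose s) * (δ * X.card) * (s + 1) := by ring
        _ ≤ 4 * ((Y.card.choose (s + 1)) * (d * X.card)) * (s + 1) :=
          Nat.mul_le_mul_right _ hchain
        _ = 4 * d * X.card * ((Y.card.choose (s + 1)) * (s + 1)) := by ring
        _ = 4 * d * X.card * ((Y.card.choose s) * (Y.card - s)) := by rw [hchoose]
        _ ≤ 4 * d * X.card * ((Y.card.choose s) * Y.card) :=
          Nat.mul_le_mul_left _ (Nat.mul_le_mul_left _ (Nat.sub_le _ _))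
        _ = _ := by ring
    exact Nat.le_of_mul_le_mul_left h6 (by positivity)
  have h7 : X.card * δ ≤ X.card * (16 * d * c ^ 2) := by
    calc X.card * δ ≤ 2 * c * (s + 1) * δ := Nat.mul_le_mul_right _ hs2.le
      _ = 2 * c * (δ * (s + 1)) := by ring
      _ ≤ 2 * c * (4 * d * (c * X.card)) :=
        Nat.mul_le_mul_left _ (h5.trans (Nat.mul_le_mul_left _ hYX))
      _ = X.card * (8 * d * c ^ 2) := by ring
      _ ≤ _ := by gcongr; omega
  exact Nat.le_of_mul_le_mul_left h7 (by omega)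

/-! ### Splitting trees and half-graphs -/

/-- `Splits r X n U` means that some full binary tree of height `n` has its inner nodes labelled by
elements of `X` and splits `U` into nonempty sets: at a node labelled `a`, the current set is split
into the neighbors and the non-neighbors of `a`. -/
def Splits {α β : Type*} (r : α → β → Prop) (X : Set α) : ℕ → Set β → Prop
  | 0, U => U.Nonempty
  | n + 1, U => ∃ a ∈ X, Splits r X n {b ∈ U | r a b} ∧ Splits r X n {b ∈ U | ¬ r a b}

theorem Splits.mono {α β : Type*} {r : α → β → Prop} {X X' : Set α} (hX : X ⊆ X') {n : ℕ} :
    ∀ {U U' : Set β}, U ⊆ U' → Splits r X n U → Splits r X' n U' := by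
  induction n with
  | zero => intro U U' hU h; exact Set.Nonempty.mono hU h
  | succ n ih =>
    rintro U U' hU ⟨a, ha, h1, h0⟩
    exact ⟨a, hX ha, ih (fun b hb => ⟨hU hb.1, hb.2⟩) h1, ih (fun b hb => ⟨hU hb.1, hb.2⟩) h0⟩

theorem Splits.of_le {α β : Type*} {r : α → β → Prop} {X : Set α} {m n : ℕ} (hmn : m ≤ n)
    {U : Set β} (h : Splits r X n U) : Splits r X m U := by
  induction hmn generalizing U with
  | refl => exact h
  | step _ ih =>
    obtain ⟨a, _, h1, _⟩ := h
    exact Splits.mono (U := {b ∈ U | r a b}) subset_rfl (fun b hb => hb.1) (ih h1)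

theorem Splits.nonempty {α β : Type*} {r : α → β → Prop} {X : Set α} {n : ℕ} {U : Set β}
    (h : Splits r X n U) : U.Nonempty :=
  h.of_le (Nat.zero_le n)

/-- Ramsey property of splitting trees: if the labels come in two colors, then a tree of height
`m + n` contains one of height `m` in the first or one of height `n` in the second color. -/
theorem Splits.union {α β : Type*} {r : α → β → Prop} {X₁ X₂ : Set α} (N : ℕ) :
    ∀ {m n : ℕ} {U : Set β}, m + n = N → Splits r (X₁ ∪ X₂) (m + n) U →
      Splits r X₁ m U ∨ Splits r X₂ n U := by
  induction N with
  | zero =>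
    intro m n U hmn h
    obtain rfl : m = 0 := by omega
    exact Or.inl h.nonempty
  | succ N ih =>
    intro m n U hmn h
    rcases m with _ | m
    · exact Or.inl h.nonempty
    rcases n with _ | n
    · exact Or.inr h.nonempty
    obtain ⟨a, ha, h1, h0⟩ := h
    rcases ha with ha | ha
    · have e : (m + 1).add n = m + (n + 1) := by change m + 1 + n = _; omega
      rw [e] at h1 h0
      rcases ih (by omega) h1 with h1 | h1
      · rcases ih (by omega) h0 with h0 | h0
        · exact Or.inl ⟨a, ha, h1, h0⟩
        · exact Or.inr (h0.mono subset_rfl fun b hb => hb.1)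
      · exact Or.inr (h1.mono subset_rfl fun b hb => hb.1)
    · rcases ih (by omega) h1 with h1 | h1
      · exact Or.inl (h1.mono subset_rfl fun b hb => hb.1)
      · rcases ih (by omega) h0 with h0 | h0
        · exact Or.inl (h0.mono subset_rfl fun b hb => hb.1)
        · exact Or.inr ⟨a, ha, h1, h0⟩

/-- A high splitting tree yields a long half-graph of one of two orientations. Given any `b ∈ U`,
the labels adjacent to `b`, or those not adjacent to `b`, still carry a high tree; its root `a` and
the vertex `b` start the half-graph, which goes on below `a` on the appropriate side. -/
theorem Splits.exists_ladder (p q : ℕ) :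
    ∃ R : ℕ, ∀ {α β : Type} (r : α → β → Prop) (X : Set α) (U : Set β), Splits r X R U →
      (∃ (a : Fin p → α) (b : Fin p → β), (∀ i, a i ∈ X) ∧ (∀ i, b i ∈ U) ∧
        ∀ i j, r (a i) (b j) ↔ j ≤ i) ∨
      ∃ (a : Fin q → α) (b : Fin q → β), (∀ i, a i ∈ X) ∧ (∀ i, b i ∈ U) ∧
        ∀ i j, r (a i) (b j) ↔ i < j := by
  induction p generalizing q with
  | zero =>
    exact ⟨0, fun r X U _ => Or.inl ⟨Fin.elim0, Fin.elim0, fun i => i.elim0, fun i => i.elim0,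
      fun i => i.elim0⟩⟩
  | succ p ihp =>
    induction q with
    | zero =>
      exact ⟨0, fun r X U _ => Or.inr ⟨Fin.elim0, Fin.elim0, fun i => i.elim0, fun i => i.elim0,
        fun i => i.elim0⟩⟩
    | succ q ihq =>
      obtain ⟨R₁, h₁⟩ := ihp (q + 1)
      obtain ⟨R₂, h₂⟩ := ihq
      refine ⟨(R₁ + 1) + (R₂ + 1), fun {α β} r X U h => ?_⟩
      obtain ⟨b₀, hb₀⟩ := h.nonempty
      have hX : X ⊆ {a ∈ X | r a b₀} ∪ {a ∈ X | ¬ r a b₀} := by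
        intro a ha
        by_cases hab : r a b₀
        · exact Or.inl ⟨ha, hab⟩
        · exact Or.inr ⟨ha, hab⟩
      rcases Splits.union _ rfl (h.mono hX subset_rfl) with h | h
      · obtain ⟨a₀, ha₀, -, h⟩ := h
        rcases h₁ r _ _ h with ⟨a, b, ha, hb, hab⟩ | ⟨a, b, ha, hb, hab⟩
        · refine Or.inl ⟨Fin.cons a₀ a, Fin.cons b₀ b, ?_, ?_, ?_⟩
          · exact Fin.cases ha₀.1 fun i => (ha i).1
          · exact Fin.cases hb₀ fun i => (hb i).1
          · intro i j
            induction i using Fin.cases with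
            | zero =>
              induction j using Fin.cases with
              | zero => simpa using ha₀.2
              | succ j => simpa using (hb j).2
            | succ i =>
              induction j using Fin.cases with
              | zero => simpa using (ha i).2
              | succ j => simpa using hab i j
        · exact Or.inr ⟨a, b, fun i => (ha i).1, fun i => (hb i).1, hab⟩
      · obtain ⟨a₀, ha₀, h, -⟩ := h
        rcases h₂ r _ _ h with ⟨a, b, ha, hb, hab⟩ | ⟨a, b, ha, hb, hab⟩
        · exact Or.inl ⟨a, b, fun i => (ha i).1, fun i => (hb i).1, hab⟩
        · refine Or.inr ⟨Fin.cons a₀ a, Fin.cons b₀ b, ?_, ?_, ?_⟩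
          · exact Fin.cases ha₀.1 fun i => (ha i).1
          · exact Fin.cases hb₀ fun i => (hb i).1
          · intro i j
            induction i using Fin.cases with
            | zero =>
              induction j using Fin.cases with
              | zero => simpa using ha₀.2
              | succ j => simpa using (hb j).2
            | succ i =>
              induction j using Fin.cases with
              | zero => simpa using (ha i).2
              | succ j => simpa using hab i j

/-- If `x i` and `y j` lie on different sides of `G` and are adjacent exactly when `i ≤ j`, then the
half-graph is an induced subgraph of `G`. -/
theorem BipGraph.nonempty_halfGraph_embedding (G : BipGraph) {t : ℕ} (A B : Set (Fin G.n))
    (hG : G.graph.IsBipartiteWith A B) (x y : Fin t → Fin G.n) (hx : ∀ i, x i ∈ A)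
    (hy : ∀ i, y i ∈ B) (hxy : ∀ i j, G.graph.Adj (x i) (y j) ↔ i ≤ j) :
    Nonempty (halfGraph t ↪g G.graph) := by
  have hne : ∀ i j, x i ≠ y j := fun i j h =>
    Set.disjoint_left.mp hG.disjoint (hx i) (h ▸ hy j)
  have hxx : ∀ i j, ¬ G.graph.Adj (x i) (x j) := fun i j h =>
    Set.disjoint_left.mp hG.disjoint (hx j) (hG.mem_of_mem_adj (hx i) h)
  have hyy : ∀ i j, ¬ G.graph.Adj (y i) (y j) := fun i j h =>
    Set.disjoint_left.mp hG.disjoint (hG.symm.mem_of_mem_adj (hy i) h) (hy j)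
  refine ⟨⟨⟨Sum.elim x y, ?_⟩, ?_⟩⟩
  · rintro (i | i) (j | j) h
    · simp only [Sum.elim_inl] at h
      have h1 := (hxy i j).mp (h ▸ (hxy j j).mpr le_rfl)
      have h2 := (hxy j i).mp (h ▸ (hxy i i).mpr le_rfl)
      rw [le_antisymm h1 h2]
    · exact absurd h (hne i j)
    · exact absurd h.symm (hne j i)
    · simp only [Sum.elim_inr] at h
      have h1 := (hxy i j).mp (h ▸ (hxy i i).mpr le_rfl)
      have h2 := (hxy j i).mp (h ▸ (hxy j j).mpr le_rfl)
      rw [le_antisymm h1 h2]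
  · rintro (i | i) (j | j)
    · change G.graph.Adj (x i) (x j) ↔ _
      simp [halfGraph, hxx]
    · change G.graph.Adj (x i) (y j) ↔ _
      simp [halfGraph, hxy]
    · change G.graph.Adj (y i) (x j) ↔ _
      simp [halfGraph, G.graph.adj_comm (y i), hxy]
    · change G.graph.Adj (y i) (y j) ↔ _
      simp [halfGraph, hyy]

/-- Monadic stability bounds the height of splitting trees labelled by the left side. -/
theorem MonadicallyStable.exists_not_splits {C : Set BipGraph} (hC : MonadicallyStable C) :
    ∃ R : ℕ, ∀ G ∈ C, ∀ U : Set (Fin G.n), U ⊆ G.right → ¬ Splits G.graph.Adj G.left R U := by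
  by_contra! hcon
  -- The transduction that takes one copy and keeps its edges produces the induced subgraphs.
  refine hC ⟨⟨1, 0, FirstOrder.Language.Relations.formula₂ (L := copyLang 0) (α := Fin 2)
    CopyRel.adj (FirstOrder.Language.Term.var 0) (FirstOrder.Language.Term.var 1)⟩, fun t => ?_⟩
  obtain ⟨R, hR⟩ := Splits.exists_ladder t (t + 1)
  obtain ⟨G, hG, U, hU, hs⟩ := hcon R
  refine ⟨G, hG, fun c => c.elim0, ?_⟩
  have hembed : Nonempty (halfGraph t ↪g G.graph) := by
    rcases hR _ _ _ hs with ⟨a, b, ha, hb, hab⟩ | ⟨a, b, ha, hb, hab⟩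
    · exact G.nonempty_halfGraph_embedding _ _ G.isBipartiteWith.symm b a (fun i => hU (hb i)) ha
        fun i j => by rw [G.graph.adj_comm, hab]
    · refine G.nonempty_halfGraph_embedding _ _ G.isBipartiteWith (fun i => a i.castSucc)
        (fun j => b j.succ) (fun i => ha _) (fun j => hU (hb _)) fun i j => ?_
      rw [hab, Fin.castSucc_lt_succ_iff]
  obtain ⟨f⟩ := hembed
  refine ⟨f.trans ⟨⟨fun v => (v, 0), fun u v h => (Prod.ext_iff.mp h).1⟩, ?_⟩⟩
  intro u v
  simp only [Transduction.image, SimpleGraph.fromRel_adj, FirstOrder.Language.Formula.realize_rel₂]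
  change _ ∧ ((_ ∧ G.graph.Adj u v) ∨ (_ ∧ G.graph.Adj v u)) ↔ _
  constructor
  · rintro ⟨-, ⟨-, h⟩ | ⟨-, h⟩⟩
    · exact h
    · exact h.symm
  · intro h
    exact ⟨fun e => h.ne (Prod.ext_iff.mp e).1, Or.inl ⟨rfl, h⟩⟩

/-! ### Near-twins and elimination orders -/

open Classical in
/-- The vertices that are the least ones with their trace on `X`. -/
noncomputable def traceReps {V : Type*} [Fintype V] [LinearOrder V] (G : SimpleGraph V)
    (X : Finset V) : Finset V :=
  Finset.univ.filter fun b => ∀ b' < b, ∃ x ∈ X, ¬ (G.Adj x b ↔ G.Adj x b')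

open Classical in
/-- The number of traces on `X` of the vertices adjacent to exactly one of `a` and `a'`. -/
noncomputable def traceDist {V : Type*} [Fintype V] [LinearOrder V] (G : SimpleGraph V)
    (X : Finset V) (a a' : V) : ℕ :=
  ((traceReps G X).filter fun b => ¬ (G.Adj a b ↔ G.Adj a' b)).card

theorem mem_traceReps {V : Type*} [Fintype V] [LinearOrder V] {G : SimpleGraph V}
    {X : Finset V} {b : V} :
    b ∈ traceReps G X ↔ ∀ b' < b, ∃ x ∈ X, ¬ (G.Adj x b ↔ G.Adj x b') := by
  simp [traceReps]

theorem traceDist_comm {V : Type*} [Fintype V] [LinearOrder V] (G : SimpleGraph V)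
    (X : Finset V) (a a' : V) : traceDist G X a a' = traceDist G X a' a := by
  classical
  rw [traceDist, traceDist]
  congr 1
  exact Finset.filter_congr fun b _ => by tauto

/-- A set of vertices that are adjacent to exactly one of `a` and `a'` and have distinct traces on
`X` has at most `traceDist G X a a'` elements, since they may be replaced by representatives. -/
theorem card_le_traceDist {V : Type*} [Fintype V] [LinearOrder V] {G : SimpleGraph V}
    {X U : Finset V} {a a' : V} (ha : a ∈ X) (ha' : a' ∈ X)
    (hU : ∀ b ∈ U, ¬ (G.Adj a b ↔ G.Adj a' b))
    (hsep : ∀ b ∈ U, ∀ b' ∈ U, b ≠ b' → ∃ x ∈ X, ¬ (G.Adj x b ↔ G.Adj x b')) :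
    U.card ≤ traceDist G X a a' := by
  classical
  have hrep : ∀ b, ∃ b' ∈ traceReps G X, ∀ x ∈ X, (G.Adj x b ↔ G.Adj x b') := by
    intro b
    have hne : (Finset.univ.filter fun b' => ∀ x ∈ X, (G.Adj x b ↔ G.Adj x b')).Nonempty :=
      ⟨b, by simp⟩
    refine ⟨_, ?_, (Finset.mem_filter.mp (Finset.min'_mem _ hne)).2⟩
    refine mem_traceReps.mpr fun b' hb' => ?_
    by_contra! h
    refine absurd (Finset.min'_le _ b' ?_) (not_le.mpr hb')
    refine Finset.mem_filter.mpr ⟨Finset.mem_univ _, fun x hx => ?_⟩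
    rw [(Finset.mem_filter.mp (Finset.min'_mem _ hne)).2 x hx]
    exact h x hx
  choose f hf hfx using hrep
  refine Finset.card_le_card_of_injOn f ?_ ?_
  · intro b hb
    refine Finset.mem_coe.mpr (Finset.mem_filter.mpr ⟨hf b, ?_⟩)
    rw [← hfx b a ha, ← hfx b a' ha']
    exact hU b hb
  · intro b hb b' hb' hbb
    by_contra hne
    obtain ⟨x, hx, hxb⟩ := hsep b hb b' hb' hne
    rw [hfx b x hx, hfx b' x hx, hbb] at hxb
    exact hxb Iff.rfl

/-- Linear neighborhood complexity provides a pair of near-twins in every set of at least two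
vertices. -/
theorem LinearNeighborhoodComplexity.exists_traceDist_le {C : Set BipGraph}
    (hC : LinearNeighborhoodComplexity C) :
    ∃ K : ℕ, ∀ G ∈ C, ∀ X : Finset (Fin G.n), 2 ≤ X.card →
      ∃ a ∈ X, ∃ a' ∈ X, a' < a ∧ traceDist G.graph X a a' ≤ K := by
  classical
  obtain ⟨c, hc⟩ := hC
  obtain ⟨d, hd0, hd⟩ : ∃ d, 0 < d ∧ c * d < 2 ^ d := by
    refine ⟨2 * c + 5, by omega, ?_⟩
    have h1 : ∀ m : ℕ, m * (2 * m + 5) < 2 ^ (2 * m + 5) := by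
      intro m
      induction m with
      | zero => norm_num
      | succ m ih =>
        have : 2 * (m + 1) + 5 = (2 * m + 5) + 2 := by ring
        rw [this, pow_add]
        have : 2 * m + 5 < 2 ^ (2 * m + 5) := Nat.lt_two_pow_self
        nlinarith
    exact h1 c
  refine ⟨16 * d * c ^ 2, fun G hG X hX => ?_⟩
  by_contra! hcon
  have hfar : ∀ a ∈ X, ∀ a' ∈ X, a ≠ a' → 16 * d * c ^ 2 + 1 ≤ traceDist G.graph X a a' := by
    intro a ha a' ha' hne
    rcases lt_or_gt_of_ne hne with h | h
    · rw [traceDist_comm]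
      exact hcon a' ha' a ha h
    · exact hcon a ha a' ha' h
  have := separation_le X (traceReps G.graph X) (fun a => Finset.univ.filter (G.graph.Adj a))
    c d (16 * d * c ^ 2 + 1) hd hd0 ?_ ?_ hX ?_
  · omega
  · intro S _ hS
    have h1 := hc G hG S (by exact_mod_cast hS)
    rw [Set.ncard_coe_finset] at h1
    refine le_trans ?_ h1
    rw [← Set.ncard_coe_finset]
    refine Set.ncard_le_ncard_of_injOn (fun s : Finset (Fin G.n) => (s : Set (Fin G.n))) ?_
      Finset.coe_injective.injOn (Set.toFinite _)
    intro s hs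
    obtain ⟨a, -, rfl⟩ := Finset.mem_image.mp hs
    exact ⟨a, by ext; simp⟩
  · have h1 := hc G hG X (Finset.coe_nonempty.mpr (Finset.card_pos.mp (by omega)))
    rw [Set.ncard_coe_finset] at h1
    refine le_trans ?_ h1
    rw [← Set.ncard_coe_finset]
    refine Set.ncard_le_ncard_of_injOn
      (fun v => G.graph.neighborSet v ∩ (X : Set (Fin G.n))) (fun v _ => ⟨v, rfl⟩) ?_
      (Set.toFinite _)
    intro v hv w hw heq
    by_contra hne
    have hcase : ∀ v w, v ∈ traceReps G.graph X → w < v →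
        G.graph.neighborSet v ∩ X = G.graph.neighborSet w ∩ X → False := by
      intro v w hv hwv heq
      obtain ⟨x, hx, hxv⟩ := mem_traceReps.mp hv w hwv
      have := Set.ext_iff.mp heq x
      simp only [Set.mem_inter_iff, SimpleGraph.mem_neighborSet, Finset.mem_coe, hx,
        and_true] at this
      rw [G.graph.adj_comm x, G.graph.adj_comm x] at hxv
      exact hxv this
    rcases lt_or_gt_of_ne hne with h | h
    · exact hcase w v hw h heq.symm
    · exact hcase v w hv h heq
  · intro a ha a' ha' hne
    refine (hfar a ha a' ha' hne).trans (Finset.card_le_card fun b hb => ?_)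
    simp only [Finset.mem_filter, Finset.mem_inter, Finset.mem_symmDiff, Finset.mem_univ,
      true_and] at hb ⊢
    exact ⟨by tauto, hb.1⟩

/-- `τ` is the removal time of an elimination of the set `A` that removes, whenever at least two
vertices are left, a vertex that has a near-twin among the vertices left. -/
structure IsElimination {V : Type*} [Fintype V] [LinearOrder V] (G : SimpleGraph V) (A : Finset V)
    (K : ℕ) (τ : V → ℕ) : Prop where
  injOn : Set.InjOn τ A
  twin : ∀ a ∈ A, (∀ x ∈ A, τ a ≤ τ x → x = a) ∨
    ∃ a' ∈ A, τ a < τ a' ∧ traceDist G (A.filter fun x => τ a ≤ τ x) a a' ≤ K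

/-- The vertex `lead b` is the neighbor of `b` that is removed last. -/
def IsLead {V : Type*} (G : SimpleGraph V) (τ : V → ℕ) (lead : V → V) (b : V) : Prop :=
  G.Adj (lead b) b ∧ ∀ a, G.Adj a b → τ a ≤ τ (lead b)

open Classical in
/-- Passing from a vertex to its near-twin changes the number of its neighbors in `U` by at most `K`
if the vertices of `U` have distinct leaders: those with a leader that is still present have
distinct traces on the vertices left, and the others have no neighbor left. At the end of the
elimination the number is at most one, so that it passes through every interval of length `K`. -/
theorem IsElimination.exists_card_mem_Icc {V : Type*} [Fintype V] [LinearOrder V]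
    {G : SimpleGraph V} {A : Finset V} {K : ℕ} {τ : V → ℕ} (hτ : IsElimination G A K τ)
    {lead : V → V} {U : Finset V} (hUA : ∀ b ∈ U, ∀ a, G.Adj a b → a ∈ A)
    (hU : ∀ b ∈ U, IsLead G τ lead b) (hinj : Set.InjOn lead U) {h : ℕ} (hh : 2 ≤ h) (n : ℕ) :
    ∀ a ∈ A, (A.filter fun x => τ a ≤ τ x).card ≤ n → h ≤ (U.filter (G.Adj a)).card →
      ∃ a' ∈ A, h ≤ (U.filter (G.Adj a')).card ∧ (U.filter (G.Adj a')).card ≤ h + K := by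
  induction n with
  | zero =>
    intro a ha hn
    rw [Nat.le_zero, Finset.card_eq_zero, Finset.filter_eq_empty_iff] at hn
    exact absurd le_rfl (hn ha)
  | succ n ih =>
    intro a ha hn hha
    by_cases hle : (U.filter (G.Adj a)).card ≤ h + K
    · exact ⟨a, ha, hha, hle⟩
    push Not at hle
    rcases hτ.twin a ha with hlast | ⟨a', ha', haa', hdist⟩
    · have hlead : ∀ b ∈ U.filter (G.Adj a), lead b = a := by
        intro b hb
        rw [Finset.mem_filter] at hb
        exact hlast _ (hUA b hb.1 _ (hU b hb.1).1) ((hU b hb.1).2 a hb.2)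
      have : (U.filter (G.Adj a)).card ≤ 1 := by
        refine Finset.card_le_one.mpr fun b hb b' hb' => ?_
        exact hinj (Finset.mem_filter.mp hb).1 (Finset.mem_filter.mp hb').1
          ((hlead b hb).trans (hlead b' hb').symm)
      omega
    · set D := U.filter fun b => ¬ (G.Adj a b ↔ G.Adj a' b) with hD
      have hlate : ∀ b ∈ D, τ a ≤ τ (lead b) := by
        intro b hb
        rw [hD, Finset.mem_filter] at hb
        by_cases hab : G.Adj a b
        · exact (hU b hb.1).2 a hab
        · have : G.Adj a' b := by tauto
          exact haa'.le.trans ((hU b hb.1).2 a' this)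
      have hDK : D.card ≤ K := by
        refine (card_le_traceDist (a := a) (a' := a') (G := G)
          (X := A.filter fun x => τ a ≤ τ x) ?_ ?_ ?_ ?_).trans hdist
        · simp [ha]
        · simp [ha', haa'.le]
        · intro b hb
          exact (Finset.mem_filter.mp hb).2
        · have hcase : ∀ b ∈ D, ∀ b' ∈ D, τ (lead b') < τ (lead b) →
              ∃ x ∈ A.filter fun x => τ a ≤ τ x, ¬ (G.Adj x b ↔ G.Adj x b') := by
            intro b hb b' hb' hlt
            have hbU := (Finset.mem_filter.mp hb).1
            have hbU' := (Finset.mem_filter.mp hb').1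
            refine ⟨lead b, Finset.mem_filter.mpr ⟨hUA b hbU _ (hU b hbU).1, hlate b hb⟩, ?_⟩
            intro hiff
            exact absurd ((hU b' hbU').2 _ (hiff.mp (hU b hbU).1)) (not_le.mpr hlt)
          intro b hb b' hb' hne
          have hbU := (Finset.mem_filter.mp hb).1
          have hbU' := (Finset.mem_filter.mp hb').1
          have hτne : τ (lead b) ≠ τ (lead b') := fun e =>
            hne (hinj hbU hbU' (hτ.injOn (hUA b hbU _ (hU b hbU).1)
              (hUA b' hbU' _ (hU b' hbU').1) e))
          rcases lt_or_gt_of_ne hτne with hlt | hlt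
          · obtain ⟨x, hx, hxb⟩ := hcase b' hb' b hb hlt
            exact ⟨x, hx, fun h => hxb h.symm⟩
          · exact hcase b hb b' hb' hlt
      refine ih a' ha' ?_ ?_
      · refine Nat.le_of_lt_succ (lt_of_lt_of_le (Finset.card_lt_card ?_) hn)
        refine Finset.ssubset_iff_of_subset (fun x hx => ?_) |>.mpr ⟨a, ?_, ?_⟩
        · rw [Finset.mem_filter] at hx ⊢
          exact ⟨hx.1, haa'.le.trans hx.2⟩
        · simp [ha]
        · simp [haa']
      · have hsub : U.filter (G.Adj a) ⊆ U.filter (G.Adj a') ∪ D := by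
          intro b hb
          rw [Finset.mem_filter] at hb
          simp only [hD, Finset.mem_union, Finset.mem_filter]
          tauto
        have := (Finset.card_le_card hsub).trans (Finset.card_union_le _ _)
        omega

/-- The size of a set of vertices with distinct leaders and a common neighbor that forces a
splitting tree of height `n`. -/
def splitBound (K : ℕ) : ℕ → ℕ
  | 0 => 1
  | n + 1 => 2 * splitBound K n + K + 1

/-- A set of vertices with distinct leaders and a common neighbor `a₀` is split into two large
pieces by some vertex on the chain of near-twins that starts at `a₀`, and so are the pieces. -/
theorem IsElimination.splits {V : Type*} [Fintype V] [LinearOrder V]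
    {G : SimpleGraph V} {A : Finset V} {K : ℕ} {τ : V → ℕ} (hτ : IsElimination G A K τ)
    {lead : V → V} {a₀ : V} (ha₀ : a₀ ∈ A) (n : ℕ) :
    ∀ U : Finset V, (∀ b ∈ U, ∀ a, G.Adj a b → a ∈ A) → (∀ b ∈ U, IsLead G τ lead b) →
      Set.InjOn lead U → (∀ b ∈ U, G.Adj a₀ b) → splitBound K n ≤ U.card →
        Splits G.Adj A n U := by
  classical
  induction n with
  | zero =>
    intro U _ _ _ _ hcard
    exact Finset.coe_nonempty.mpr (Finset.card_pos.mp hcard)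
  | succ n ih =>
    intro U hUA hU hinj hUa hcard
    rw [splitBound] at hcard
    have hpos : 1 ≤ splitBound K n := by cases n <;> simp [splitBound]
    obtain ⟨a, ha, h1, h2⟩ := hτ.exists_card_mem_Icc hUA hU hinj (h := splitBound K n + 1)
      (by omega) _ a₀ ha₀ le_rfl (by rw [Finset.filter_true_of_mem hUa]; omega)
    have hadd := Finset.card_filter_add_card_filter_not (s := U) (G.Adj a)
    have hsub : ∀ (p : V → Prop) [DecidablePred p], splitBound K n ≤ (U.filter p).card →
        Splits G.Adj A n {b ∈ (U : Set V) | p b} := by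
      intro p _ hp
      have := ih (U.filter p) (fun b hb => hUA b (Finset.mem_filter.mp hb).1)
        (fun b hb => hU b (Finset.mem_filter.mp hb).1)
        (hinj.mono (Finset.coe_subset.mpr (Finset.filter_subset _ _)))
        (fun b hb => hUa b (Finset.mem_filter.mp hb).1) hp
      rwa [Finset.coe_filter] at this
    exact ⟨a, ha, hsub _ (by omega), hsub _ (by omega)⟩

/-! ### Coloring the leaders -/

/-- Greedy coloring: if every vertex is in conflict with at most `k` vertices of larger rank, then
`k + 1` colors suffice. -/
theorem exists_greedy_coloring {V : Type*} [Finite V] (τ : V → ℕ) (D : V → Set V) (k : ℕ)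
    (hD : ∀ a, ∀ b ∈ D a, τ a < τ b) (hk : ∀ a, (D a).ncard ≤ k) :
    ∃ col : V → Fin (k + 1), ∀ a, ∀ b ∈ D a, col a ≠ col b := by
  obtain ⟨N, hN⟩ : ∃ N, ∀ a, τ a < N := by
    obtain ⟨N, hN⟩ := (Set.finite_range τ).bddAbove
    exact ⟨N + 1, fun a => Nat.lt_succ_of_le (hN ⟨a, rfl⟩)⟩
  have key : ∀ n ≤ N, ∃ col : V → Fin (k + 1),
      ∀ a, N ≤ τ a + n → ∀ b ∈ D a, col a ≠ col b := by
    intro n hn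
    induction n with
    | zero => exact ⟨fun _ => 0, fun a ha => absurd (hN a) (by omega)⟩
    | succ n ih =>
      obtain ⟨col, hcol⟩ := ih (by omega)
      have hfree : ∀ a, ∃ x, x ∉ col '' D a := by
        intro a
        by_contra! h
        have h1 : (col '' D a).ncard ≤ k := (Set.ncard_image_le (Set.toFinite _)).trans (hk a)
        rw [Set.eq_univ_of_forall h, Set.ncard_univ, Nat.card_eq_fintype_card, Fintype.card_fin]
          at h1
        omega
      choose f hf using hfree
      refine ⟨fun a => if N = τ a + n + 1 then f a else col a, fun a ha b hb => ?_⟩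
      have hab := hD a b hb
      simp only
      rw [if_neg (show ¬ N = τ b + n + 1 by omega)]
      split_ifs with h
      · intro e
        exact hf a (e ▸ ⟨b, hb, rfl⟩)
      · exact hcol a (by omega) b hb
  obtain ⟨col, hcol⟩ := key N le_rfl
  exact ⟨col, fun a => hcol a (by omega)⟩

/-! ### Bounded executions of the random access machine -/

namespace RAM

/-- `Runs W p s T Q`: from `s`, the program `p` halts after at most `T` steps in a state with
property `Q`. -/
def Runs (W : ℕ) (p : Prog) (s : State) (T : ℕ) (Q : State → Prop) : Prop :=
  ∃ t s', Exec W p s t s' ∧ t ≤ T ∧ Q s'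

@[simp] theorem State.setReg_reg (s : State) (d x r : ℕ) :
    (s.setReg d x).reg r = if r = d then x else s.reg r := by
  simp [State.setReg, Function.update_apply]

@[simp] theorem State.setReg_mem (s : State) (d x : ℕ) : (s.setReg d x).mem = s.mem := rfl

@[simp] theorem State.setMem_reg (s : State) (i x : ℕ) : (s.setMem i x).reg = s.reg := rfl

@[simp] theorem State.setMem_mem (s : State) (i x j : ℕ) :
    (s.setMem i x).mem j = if j = i then x else s.mem j := by
  simp [State.setMem, Function.update_apply]

variable {W : ℕ} {p q : Prog} {s : State} {T T' : ℕ} {Q Q' : State → Prop}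

theorem Runs.mono (h : Runs W p s T Q) (hT : T ≤ T') (hQ : ∀ s', Q s' → Q' s') :
    Runs W p s T' Q' := by
  obtain ⟨t, s', he, ht, hs'⟩ := h
  exact ⟨t, s', he, ht.trans hT, hQ s' hs'⟩

theorem Runs.seq (h : Runs W p s T Q) (hq : ∀ s', Q s' → Runs W q s' T' Q') :
    Runs W (.seq p q) s (T + T') Q' := by
  obtain ⟨t, s', he, ht, hs'⟩ := h
  obtain ⟨t', s'', he', ht', hs''⟩ := hq s' hs'
  exact ⟨t + t', s'', .seq he he', by omega, hs''⟩

theorem Runs.skip (h : Q s) : Runs W .skip s 1 Q := ⟨1, s, .skip s, le_rfl, h⟩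

theorem Runs.const {d k : ℕ} (hk : k ≤ W) (h : Q (s.setReg d k)) : Runs W (.const d k) s 1 Q :=
  ⟨1, _, .const s d k hk, le_rfl, h⟩

theorem Runs.add {d a b : ℕ} (v : ℕ) (hv : s.reg a + s.reg b = v) (hW : v ≤ W)
    (h : Q (s.setReg d v)) : Runs W (.add d a b) s 1 Q :=
  ⟨1, _, .add s d a b (hv.trans_le hW), le_rfl, hv ▸ h⟩

theorem Runs.sub {d a b : ℕ} (v : ℕ) (hv : s.reg a - s.reg b = v) (h : Q (s.setReg d v)) :
    Runs W (.sub d a b) s 1 Q :=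
  ⟨1, _, .sub s d a b, le_rfl, hv ▸ h⟩

theorem Runs.mul {d a b : ℕ} (v : ℕ) (hv : s.reg a * s.reg b = v) (hW : v ≤ W)
    (h : Q (s.setReg d v)) : Runs W (.mul d a b) s 1 Q :=
  ⟨1, _, .mul s d a b (hv.trans_le hW), le_rfl, hv ▸ h⟩

theorem Runs.load {d a : ℕ} (v : ℕ) (hv : s.mem (s.reg a) = v) (h : Q (s.setReg d v)) :
    Runs W (.load d a) s 1 Q :=
  ⟨1, _, .load s d a, le_rfl, hv ▸ h⟩

theorem Runs.store {a b : ℕ} (i v : ℕ) (hi : s.reg a = i) (hv : s.reg b = v)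
    (h : Q (s.setMem i v)) : Runs W (.store a b) s 1 Q :=
  ⟨1, _, .store s a b, le_rfl, hi ▸ hv ▸ h⟩

theorem Runs.ite {a b : ℕ} (h₁ : s.reg a < s.reg b → Runs W p s T Q)
    (h₂ : ¬ s.reg a < s.reg b → Runs W q s T Q) : Runs W (.ite a b p q) s (T + 1) Q := by
  by_cases h : s.reg a < s.reg b
  · obtain ⟨t, s', he, ht, hs'⟩ := h₁ h
    exact ⟨t + 1, s', .ite_true h he, by omega, hs'⟩
  · obtain ⟨t, s', he, ht, hs'⟩ := h₂ h
    exact ⟨t + 1, s', .ite_false h he, by omega, hs'⟩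

theorem Runs.seqOfEq {s₁ : State} (h : Runs W p s 1 fun s' => s' = s₁)
    (hq : Runs W q s₁ T Q) : Runs W (.seq p q) s (T + 1) Q :=
  (h.seq (by rintro _ rfl; exact hq)).mono (by omega) fun _ h => h

theorem Runs.constSeq {d k : ℕ} (hk : k ≤ W) (h : Runs W q (s.setReg d k) T Q) :
    Runs W (.seq (.const d k) q) s (T + 1) Q :=
  Runs.seqOfEq (by exact Runs.const hk rfl) h

theorem Runs.addSeq {d a b : ℕ} (v : ℕ) (hv : s.reg a + s.reg b = v) (hW : v ≤ W)
    (h : Runs W q (s.setReg d v) T Q) : Runs W (.seq (.add d a b) q) s (T + 1) Q :=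
  Runs.seqOfEq (by exact Runs.add v hv hW rfl) h

theorem Runs.subSeq {d a b : ℕ} (v : ℕ) (hv : s.reg a - s.reg b = v)
    (h : Runs W q (s.setReg d v) T Q) : Runs W (.seq (.sub d a b) q) s (T + 1) Q :=
  Runs.seqOfEq (by exact Runs.sub v hv rfl) h

theorem Runs.mulSeq {d a b : ℕ} (v : ℕ) (hv : s.reg a * s.reg b = v) (hW : v ≤ W)
    (h : Runs W q (s.setReg d v) T Q) : Runs W (.seq (.mul d a b) q) s (T + 1) Q :=
  Runs.seqOfEq (by exact Runs.mul v hv hW rfl) h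

theorem Runs.loadSeq {d a : ℕ} (v : ℕ) (hv : s.mem (s.reg a) = v)
    (h : Runs W q (s.setReg d v) T Q) : Runs W (.seq (.load d a) q) s (T + 1) Q :=
  Runs.seqOfEq (by exact Runs.load v hv rfl) h

theorem Runs.storeSeq {a b : ℕ} (i v : ℕ) (hi : s.reg a = i) (hv : s.reg b = v)
    (h : Runs W q (s.setMem i v) T Q) : Runs W (.seq (.store a b) q) s (T + 1) Q :=
  Runs.seqOfEq (by exact Runs.store i v hi hv rfl) h

/-- A counting loop with invariant `I`. -/
theorem Runs.loop {a b N : ℕ} (I : ℕ → State → Prop)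
    (hreg : ∀ j s, I j s → s.reg a = j ∧ s.reg b = N)
    (hbody : ∀ j s, j < N → I j s → Runs W p s T (I (j + 1))) (h0 : I 0 s) :
    Runs W (.loop a b p) s (N * (T + 1) + 1) (I N) := by
  have key : ∀ m j s, j + m = N → I j s → Runs W (.loop a b p) s (m * (T + 1) + 1) (I N) := by
    intro m
    induction m with
    | zero =>
      intro j s hj hI
      obtain ⟨ha, hb⟩ := hreg j s hI
      obtain rfl : j = N := by omega
      exact ⟨1, s, .loop_false (by omega), by omega, hI⟩
    | succ m ih =>
      intro j s hj hI
      obtain ⟨ha, hb⟩ := hreg j s hI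
      obtain ⟨t, s', he, ht, hs'⟩ := hbody j s (by omega) hI
      obtain ⟨t', s'', he', ht', hs''⟩ := ih (j + 1) s' (by omega) hs'
      refine ⟨t + t' + 1, s'', .loop_true (by omega) he he', ?_, hs''⟩
      rw [Nat.succ_mul]
      omega
  exact key N 0 s (by omega) h0

end RAM

/-! ### Distances between rows of the adjacency matrix -/

open RAM

/-- Sequential composition of programs. -/
local infixr:60 " ;; " => Prog.seq

/-- Register `10` receives the number of positions in which the rows `reg 8` and `reg 9` of the
adjacency matrix differ, among the positions marked in the array at `reg 7`. -/
def distProg : Prog :=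
  .const 10 0 ;; .mul 11 8 0 ;; .add 11 11 0 ;; .mul 12 9 0 ;; .add 12 12 0 ;; .const 13 0 ;;
    .loop 13 0 (.add 14 11 13 ;; .load 14 14 ;; .add 15 12 13 ;; .load 15 15 ;; .sub 16 14 15 ;;
      .sub 15 15 14 ;; .add 16 16 15 ;; .add 14 7 13 ;; .load 14 14 ;; .mul 16 16 14 ;;
      .add 10 10 16 ;; .add 13 13 1)

/-- The contribution of position `z` to the number computed by `distProg` for the rows `x` and `y`
and the marks at `B`. -/
def distTerm (n : ℕ) (m : ℕ → ℕ) (B x y z : ℕ) : ℕ :=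
  ((m (x * n + n + z) - m (y * n + n + z)) + (m (y * n + n + z) - m (x * n + n + z))) * m (B + z)

theorem runs_distProg {W n : ℕ} {s : State} {B x y : ℕ} (h0 : s.reg 0 = n) (h1 : s.reg 1 = 1)
    (hB : s.reg 7 = B) (hx : s.reg 8 = x) (hy : s.reg 9 = y) (hxn : x < n) (hyn : y < n)
    (hBW : B + n ≤ W) (hW : n + n * n ≤ W) (hadj : ∀ u z, u < n → z < n → s.mem (u * n + n + z) ≤ 1)
    (hmask : ∀ z, z < n → s.mem (B + z) ≤ 1) :
    Runs W distProg s (13 * n + 7) fun s' => s'.mem = s.mem ∧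
      s'.reg 10 = ∑ z ∈ Finset.range n, distTerm n s.mem B x y z ∧
        ∀ r, r < 10 ∨ 17 ≤ r → s'.reg r = s.reg r := by
  have hterm : ∀ z, z < n → distTerm n s.mem B x y z ≤ 1 := by
    intro z hz
    have e1 := hadj x z hxn hz
    have e2 := hadj y z hyn hz
    have e3 := hmask z hz
    rw [distTerm]
    calc _ ≤ 1 * 1 := Nat.mul_le_mul (by omega) e3
      _ = 1 := rfl
  have hrow : ∀ u, u < n → u * n + n ≤ n * n := by
    intro u hu
    calc u * n + n = (u + 1) * n := by ring
      _ ≤ n * n := Nat.mul_le_mul_right _ hu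
  have hxr := hrow x hxn
  have hyr := hrow y hyn
  have hsum : ∀ j ≤ n, ∑ z ∈ Finset.range j, distTerm n s.mem B x y z ≤ j := by
    intro j hj
    calc _ ≤ ∑ z ∈ Finset.range j, 1 :=
          Finset.sum_le_sum fun z hz => hterm z ((Finset.mem_range.mp hz).trans_le hj)
      _ = j := by simp
  rw [distProg]
  refine Runs.mono (T := (n * (12 + 1) + 1) + 6) ?_ (by omega) fun _ h => h
  refine Runs.constSeq (by omega) ?_
  refine Runs.mulSeq (x * n) (by simp [h0, hx]) (by omega) ?_
  refine Runs.addSeq (x * n + n) (by simp [h0]) (by omega) ?_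
  refine Runs.mulSeq (y * n) (by simp [h0, hy]) (by omega) ?_
  refine Runs.addSeq (y * n + n) (by simp [h0]) (by omega) ?_
  refine Runs.constSeq (by omega) ?_
  refine Runs.mono (Runs.loop (N := n) (fun j s' => s'.mem = s.mem ∧ s'.reg 13 = j ∧
    s'.reg 11 = x * n + n ∧ s'.reg 12 = y * n + n ∧
    s'.reg 10 = ∑ z ∈ Finset.range j, distTerm n s.mem B x y z ∧
        ∀ r, r < 10 ∨ 17 ≤ r → s'.reg r = s.reg r) ?_ ?_ ?_) le_rfl ?_
  · rintro j s' ⟨-, h13, -, -, -, hf⟩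
    exact ⟨h13, by rw [hf 0 (by omega), h0]⟩
  · rintro j s' hj ⟨hm, h13, h11, h12, h10, hf⟩
    have f0 := (hf 0 (by omega)).trans h0
    have f1 := (hf 1 (by omega)).trans h1
    have f7 := (hf 7 (by omega)).trans hB
    have e1 := hadj x j hxn hj
    have e2 := hadj y j hyn hj
    have e3 := hterm j hj
    have e4 := hsum j hj.le
    refine Runs.addSeq (x * n + n + j) (by rw [h11, h13]) (by omega) ?_
    refine Runs.loadSeq (s.mem (x * n + n + j)) (by simp [hm]) ?_
    refine Runs.addSeq (y * n + n + j) (by simp [h12, h13]) (by omega) ?_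
    refine Runs.loadSeq (s.mem (y * n + n + j)) (by simp [hm]) ?_
    refine Runs.subSeq (s.mem (x * n + n + j) - s.mem (y * n + n + j)) (by simp) ?_
    refine Runs.subSeq (s.mem (y * n + n + j) - s.mem (x * n + n + j)) (by simp) ?_
    refine Runs.addSeq ((s.mem (x * n + n + j) - s.mem (y * n + n + j)) +
      (s.mem (y * n + n + j) - s.mem (x * n + n + j))) (by simp) (by omega) ?_
    refine Runs.addSeq (B + j) (by simp [f7, h13]) (by omega) ?_
    refine Runs.loadSeq (s.mem (B + j)) (by simp [hm]) ?_
    refine Runs.mulSeq (distTerm n s.mem B x y j) (by simp [distTerm]) (by omega) ?_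
    refine Runs.addSeq (∑ z ∈ Finset.range (j + 1), distTerm n s.mem B x y z)
      (by simp [h10, Finset.sum_range_succ]) (by rw [Finset.sum_range_succ]; omega) ?_
    refine Runs.add (j + 1) (by simp [f1, h13]) (by omega) ?_
    refine ⟨by simp [hm], by simp, by simp [h11], by simp [h12], by simp, fun r hr => ?_⟩
    simp only [State.setReg_reg]
    repeat rw [if_neg (by omega)]
    exact hf r hr
  · refine ⟨by simp, by simp, by simp, by simp, by simp, fun r hr => ?_⟩
    simp only [State.setReg_reg]
    repeat rw [if_neg (by omega)]
  · rintro s' ⟨hm, -, -, -, h10, hf⟩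
    exact ⟨hm, h10, hf⟩

/-! ### The memory during the elimination -/

open Classical in
/-- The memory holds the indicator of the set `X` of vertices left, the adjacency matrix, and the
labels `L`. The array of representatives, between the matrix and the labels, is not constrained. -/
structure BipGraph.View (G : BipGraph) (X : Finset (Fin G.n)) (L : Fin G.n → ℕ) (m : ℕ → ℕ) :
    Prop where
  alive : ∀ v : Fin G.n, m v = if v ∈ X then 1 else 0
  adj : ∀ u v : Fin G.n, m (u * G.n + G.n + v) = if G.graph.Adj u v then 1 else 0
  label : ∀ v : Fin G.n, m (G.n * G.n + G.n + G.n + v) = L v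

/-- The values of the registers that stay constant during the elimination: the numbers `n`, `1` and
`0`, the addresses of the array of representatives and of the array of labels, and the first number
that is too large for the distance of near-twins. -/
structure Setup (n K : ℕ) (s : State) : Prop where
  size : s.reg 0 = n
  one : s.reg 1 = 1
  zero : s.reg 2 = 0
  reps : s.reg 4 = n * n + n
  labels : s.reg 5 = n * n + n + n
  bound : s.reg 6 = K + 1

theorem Setup.of_eq {n K : ℕ} {s s' : State} (h : Setup n K s)
    (hs : ∀ r < 7, s'.reg r = s.reg r) : Setup n K s' :=
  ⟨by rw [hs 0 (by omega), h.size], by rw [hs 1 (by omega), h.one],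
    by rw [hs 2 (by omega), h.zero], by rw [hs 4 (by omega), h.reps],
    by rw [hs 5 (by omega), h.labels], by rw [hs 6 (by omega), h.bound]⟩

theorem row_add_lt {n u : ℕ} (hu : u < n) : u * n + n ≤ n * n := by
  calc u * n + n = (u + 1) * n := by ring
    _ ≤ n * n := Nat.mul_le_mul_right _ hu

open Classical in
theorem runs_distProg_card {W K : ℕ} {G : BipGraph} {X : Finset (Fin G.n)} {L : Fin G.n → ℕ}
    {s : State} (hs : Setup G.n K s) (hv : G.View X L s.mem)
    (hW : G.n * G.n + G.n + G.n + G.n ≤ W) {B : ℕ} (hB : s.reg 7 = B)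
    (hBW : B ≤ G.n * G.n + G.n) (S : Finset (Fin G.n))
    (hS : ∀ z : Fin G.n, s.mem (B + z) = if z ∈ S then 1 else 0) (x y : Fin G.n)
    (hx : s.reg 8 = x) (hy : s.reg 9 = y) :
    Runs W distProg s (13 * G.n + 7) fun s' => s'.mem = s.mem ∧
      s'.reg 10 = (S.filter fun z => ¬ (G.graph.Adj x z ↔ G.graph.Adj y z)).card ∧
        ∀ r, r < 10 ∨ 17 ≤ r → s'.reg r = s.reg r := by
  refine (runs_distProg (n := G.n) hs.size hs.one hB hx hy x.2 y.2 (by omega) (by omega) ?_ ?_).mono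
    le_rfl ?_
  · intro u z hu hz
    rw [hv.adj ⟨u, hu⟩ ⟨z, hz⟩]
    split_ifs <;> omega
  · intro z hz
    rw [hS ⟨z, hz⟩]
    split_ifs <;> omega
  · rintro s' ⟨hm, h10, hf⟩
    refine ⟨hm, ?_, hf⟩
    have hfilter : (S.filter fun z => ¬ (G.graph.Adj x z ↔ G.graph.Adj y z)) =
        Finset.univ.filter fun z => z ∈ S ∧ ¬ (G.graph.Adj x z ↔ G.graph.Adj y z) := by
      ext; simp
    rw [h10, Finset.sum_range, hfilter, Finset.card_filter]
    refine Finset.sum_congr rfl fun z _ => ?_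
    rw [distTerm, hv.adj, hv.adj, hS]
    by_cases h1 : G.graph.Adj x z <;> by_cases h2 : G.graph.Adj y z <;> by_cases h3 : z ∈ S <;>
      simp [h1, h2, h3]

/-! ### Computing the representatives -/

/-- Register `19` is set to zero if the vertices `reg 17` and `reg 18` have the same trace. -/
def repsStepProg : Prog :=
  .add 8 17 2 ;; .add 9 18 2 ;; distProg ;; .ite 10 1 (.const 19 0) .skip ;; .add 18 18 1

/-- Marks the vertices that are the least ones with their trace on the vertices left. -/
def repsProg : Prog :=
  .const 7 0 ;; .const 17 0 ;; .loop 17 0 (.const 19 1 ;; .const 18 0 ;; .loop 18 17 repsStepProg ;;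
    .add 14 4 17 ;; .store 14 19 ;; .add 17 17 1)

open Classical in
/-- The state, relative to the state `s` before, once the trace of `i` has been compared with the
traces of the vertices below `j`. -/
structure RepsState (G : BipGraph) (X : Finset (Fin G.n)) (s : State) (i : Fin G.n) (j : ℕ)
    (s' : State) : Prop where
  mem : s'.mem = s.mem
  inner : s'.reg 18 = j
  outer : s'.reg 17 = i
  mask : s'.reg 7 = 0
  flag : s'.reg 19 = if ∀ b' : Fin G.n, (b' : ℕ) < j →
    ∃ x ∈ X, ¬ (G.graph.Adj x i ↔ G.graph.Adj x b') then 1 else 0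
  frame : ∀ r, r < 7 ∨ 21 ≤ r → s'.reg r = s.reg r

open Classical in
theorem runs_repsStepProg {W K : ℕ} {G : BipGraph} {X : Finset (Fin G.n)} {L : Fin G.n → ℕ}
    {s : State} (hs : Setup G.n K s) (hv : G.View X L s.mem)
    (hW : G.n * G.n + G.n + G.n + G.n ≤ W) (hW1 : 1 ≤ W) {i j : Fin G.n}
    {s₂ : State} (h : RepsState G X s i j s₂) :
    Runs W repsStepProg s₂ (13 * G.n + 12) (RepsState G X s i (j + 1)) := by
  obtain ⟨hm₂, h18, h17, h7, h19, hf⟩ := h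
  have hi := i.2
  have hjn := j.2
  have hs₂ : Setup G.n K s₂ := hs.of_eq fun r hr => hf r (Or.inl hr)
  rw [repsStepProg]
  refine Runs.mono (T := (13 * G.n + 7 + (1 + 1 + 1)) + 1 + 1) ?_ (by omega) fun _ h => h
  refine Runs.addSeq i (by simp [h17, hs₂.zero]) (by omega) ?_
  refine Runs.addSeq j (by simp [h18, hs₂.zero]) (by omega) ?_
  refine Runs.seq (T := 13 * G.n + 7) (T' := 1 + 1 + 1) (runs_distProg_card (K := K) (X := X)
    (L := L) (B := 0) ?_ ?_ hW ?_ (by omega) X ?_ i j ?_ ?_) ?_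
  · refine hs₂.of_eq fun r hr => ?_
    simp only [State.setReg_reg]
    repeat rw [if_neg (by omega)]
  · simpa [hm₂] using hv
  · simp [h7]
  · intro z
    simp [hm₂, hv.alive]
  · simp
  · simp
  rintro s₃ ⟨hm₃, h10, hf₃⟩
  have hf₃' : ∀ r, r < 8 ∨ 17 ≤ r → s₃.reg r = s₂.reg r := by
    intro r hr
    rw [hf₃ r (by omega)]
    simp only [State.setReg_reg]
    repeat rw [if_neg (by omega)]
  have h1 : s₃.reg 1 = 1 := by rw [hf₃' 1 (by omega), hs₂.one]
  have h18' : s₃.reg 18 = j := by rw [hf₃' 18 (by omega), h18]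
  have h17' : s₃.reg 17 = i := by rw [hf₃' 17 (by omega), h17]
  have h19' := (hf₃' 19 (by omega)).trans h19
  have h7' : s₃.reg 7 = 0 := by rw [hf₃' 7 (by omega), h7]
  have hm₃' : s₃.mem = s.mem := by rw [hm₃]; simpa using hm₂
  -- The distance is zero exactly if the two vertices have the same trace.
  have h10' : s₃.reg 10 = 0 ↔ ∀ x ∈ X, (G.graph.Adj x i ↔ G.graph.Adj x j) := by
    rw [h10, Finset.card_eq_zero, Finset.filter_eq_empty_iff]
    simp only [not_not, G.graph.adj_comm]
  have hstep : (∀ b' : Fin G.n, (b' : ℕ) < j + 1 →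
        ∃ x ∈ X, ¬ (G.graph.Adj x i ↔ G.graph.Adj x b')) ↔
      (∀ b' : Fin G.n, (b' : ℕ) < j →
        ∃ x ∈ X, ¬ (G.graph.Adj x i ↔ G.graph.Adj x b')) ∧ s₃.reg 10 ≠ 0 := by
    rw [Ne, h10']
    push Not
    constructor
    · intro h
      refine ⟨fun b' hb' => h b' (by omega), ?_⟩
      obtain ⟨x, hx, hxb⟩ := h j (Nat.lt_succ_self j)
      exact ⟨x, hx, by tauto⟩
    · rintro ⟨h, x, hx, hxb⟩ b' hb'
      rcases Nat.lt_succ_iff_lt_or_eq.mp hb' with hb' | hb'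
      · exact h b' hb'
      · rw [Fin.ext hb']
        exact ⟨x, hx, by tauto⟩
  refine Runs.seq (Q := fun s' => s'.mem = s.mem ∧ s'.reg 18 = j ∧ s'.reg 1 = 1 ∧
    s'.reg 17 = i ∧ s'.reg 7 = 0 ∧ s'.reg 19 = (if ∀ b' : Fin G.n, (b' : ℕ) < j + 1 →
      ∃ x ∈ X, ¬ (G.graph.Adj x i ↔ G.graph.Adj x b') then 1 else 0) ∧
    ∀ r, r < 7 ∨ 21 ≤ r → s'.reg r = s.reg r) (Runs.ite ?_ ?_) ?_
  · intro hlt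
    have h0 : s₃.reg 10 = 0 := by omega
    refine Runs.const (by omega) ⟨by simpa using hm₃', by simpa using h18', by simpa using h1,
      by simpa using h17', by simpa using h7', ?_, fun r hr => ?_⟩
    · rw [if_neg (by rw [hstep]; exact fun h => h.2 h0)]
      simp
    · rw [State.setReg_reg, if_neg (by omega), hf₃' r (by omega), hf r hr]
  · intro hlt
    refine Runs.skip ⟨hm₃', h18', h1, h17', h7', ?_, fun r hr => ?_⟩
    · rw [h19']
      have h0 : s₃.reg 10 ≠ 0 := by omega
      congr 1
      rw [hstep]
      simp [h0]
    · rw [hf₃' r (by omega), hf r hr]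
  · rintro s₄ ⟨hm₄, h18, h1, h17, h7, h19, hf₄⟩
    refine Runs.add (j + 1) (by rw [h18, h1]) (by omega) ?_
    refine ⟨by simpa using hm₄, by simp, by simpa using h17, by simpa using h7,
      by simpa using h19, fun r hr => ?_⟩
    rw [State.setReg_reg, if_neg (by omega), hf₄ r hr]

open Classical in
theorem runs_repsProg {W K : ℕ} {G : BipGraph} {X : Finset (Fin G.n)} {L : Fin G.n → ℕ}
    {s : State} (hs : Setup G.n K s) (hv : G.View X L s.mem)
    (hW : G.n * G.n + G.n + G.n + G.n ≤ W) (hW1 : 1 ≤ W) :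
    Runs W repsProg s (G.n * (G.n * (13 * G.n + 13) + 7) + 3) fun s' => G.View X L s'.mem ∧
      (∀ b : Fin G.n, s'.mem (G.n * G.n + G.n + b) = if b ∈ traceReps G.graph X then 1 else 0) ∧
        ∀ r, r < 7 ∨ 21 ≤ r → s'.reg r = s.reg r := by
  rw [repsProg]
  obtain ⟨T, hT⟩ : ∃ T, T = G.n * (13 * G.n + 13) + 1 := ⟨_, rfl⟩
  obtain ⟨T', hT'⟩ : ∃ T', T' = G.n * ((T + 3 + 1 + 1) + 1) + 1 := ⟨_, rfl⟩
  refine Runs.mono (T := T' + 1 + 1) ?_ (by rw [hT', hT]) fun _ h => h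
  refine Runs.constSeq (by omega) ?_
  refine Runs.constSeq (by omega) ?_
  refine Runs.mono (T := G.n * ((T + 3 + 1 + 1) + 1) + 1)
    (Runs.loop (N := G.n) (fun i s' => G.View X L s'.mem ∧ s'.reg 17 = i ∧ s'.reg 7 = 0 ∧
      (∀ b : Fin G.n, (b : ℕ) < i →
        s'.mem (G.n * G.n + G.n + b) = if b ∈ traceReps G.graph X then 1 else 0) ∧
      ∀ r, r < 7 ∨ 21 ≤ r → s'.reg r = s.reg r) ?_ ?_ ?_) hT'.ge ?_
  · rintro i s' ⟨-, h17, -, -, hf⟩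
    exact ⟨h17, by rw [hf 0 (by omega), hs.size]⟩
  · rintro i s₁ hi ⟨hv₁, h17, h7, hr, hf⟩
    have hs₁ : Setup G.n K s₁ := hs.of_eq fun r hr => hf r (Or.inl hr)
    refine Runs.constSeq (by omega) ?_
    refine Runs.constSeq (by omega) ?_
    refine Runs.seq (T := T) (T' := 3) (Runs.mono (T := i * (13 * G.n + 12 + 1) + 1)
      (Runs.loop (N := i) (RepsState G X s₁ ⟨i, hi⟩) (fun j s' h => ⟨h.inner, h.outer⟩)
        (fun j s' hj h => runs_repsStepProg hs₁ hv₁ hW hW1 (j := ⟨j, hj.trans hi⟩) h) ?_)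
      ?_ fun _ h => h) ?_
    · refine ⟨by simp, by simp, by simpa using h17, by simpa using h7, by simp, fun r hr => ?_⟩
      simp only [State.setReg_reg]
      repeat rw [if_neg (by omega)]
    · have : i * (13 * G.n + 12 + 1) ≤ G.n * (13 * G.n + 13) := Nat.mul_le_mul hi.le (by omega)
      omega
    · rintro s₂ ⟨hm₂, h18, h17, h7, h19, hf₂⟩
      have hs₂ : Setup G.n K s₂ := hs₁.of_eq fun r hr => hf₂ r (Or.inl hr)
      refine Runs.addSeq (G.n * G.n + G.n + i) (by rw [hs₂.reps, h17]) (by omega) ?_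
      refine Runs.storeSeq (G.n * G.n + G.n + i)
        (if (⟨i, hi⟩ : Fin G.n) ∈ traceReps G.graph X then 1 else 0) (by simp) ?_ ?_
      · rw [State.setReg_reg, if_neg (by omega), h19]
        congr 1
        rw [mem_traceReps]
        rfl
      refine Runs.add (i + 1) (by simp [h17, hs₂.one]) (by omega) ?_
      refine ⟨⟨fun v => ?_, fun u v => ?_, fun v => ?_⟩, by simp, by simpa using h7,
        fun b hb => ?_, fun r hr => ?_⟩
      · simp only [State.setReg_mem, State.setMem_mem]
        rw [if_neg (by omega), hm₂, hv₁.alive]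
      · simp only [State.setReg_mem, State.setMem_mem]
        have := row_add_lt u.2
        rw [if_neg (by omega), hm₂, hv₁.adj]
      · simp only [State.setReg_mem, State.setMem_mem]
        rw [if_neg (by omega), hm₂, hv₁.label]
      · simp only [State.setReg_mem, State.setMem_mem, hm₂]
        by_cases hbi : (b : ℕ) = i
        · subst hbi
          simp
        · rw [if_neg (by omega), hr b (by omega)]
      · simp only [State.setReg_reg, State.setMem_reg]
        repeat rw [if_neg (by omega)]
        rw [hf₂ r hr, hf r hr]
  · refine ⟨by simpa using hv, by simp, by simp, fun b hb => absurd hb (by omega), fun r hr => ?_⟩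
    simp only [State.setReg_reg]
    repeat rw [if_neg (by omega)]
  · rintro s' ⟨hv', -, -, hr, hf⟩
    exact ⟨hv', fun b => hr b b.2, hf⟩

/-! ### Searching a vertex with a near-twin -/

/-- `a` has a near-twin among the smaller vertices of `X`. -/
def HasTwin {V : Type*} [Fintype V] [LinearOrder V] (G : SimpleGraph V) (K : ℕ) (X : Finset V)
    (a : V) : Prop :=
  ∃ a' ∈ X, a' < a ∧ traceDist G X a a' ≤ K

/-- Register value `c` names a vertex of `X`, or is `n` if `X` is empty. If `Q` holds, then that
vertex has a near-twin. -/
structure IsCandidate (G : BipGraph) (K : ℕ) (X : Finset (Fin G.n)) (Q : Prop) (c : ℕ) : Prop where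
  empty : X = ∅ → c = G.n
  nonempty : X.Nonempty → ∃ a ∈ X, c = a ∧ (Q → HasTwin G.graph K X a)

/-- Register `21` receives the last vertex left, or `n` if there is none. -/
def lastProg : Prog :=
  .add 21 0 2 ;; .const 17 0 ;; .loop 17 0 (.load 14 17 ;; .ite 2 14 (.add 21 17 2) .skip ;;
    .add 17 17 1)

theorem runs_lastProg {W K : ℕ} {G : BipGraph} {X : Finset (Fin G.n)} {L : Fin G.n → ℕ}
    {s : State} (hs : Setup G.n K s) (hv : G.View X L s.mem)
    (hW : G.n * G.n + G.n + G.n + G.n ≤ W) (hW1 : 1 ≤ W) :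
    Runs W lastProg s (G.n * 5 + 3) fun s' => s'.mem = s.mem ∧
      IsCandidate G K X False (s'.reg 21) ∧ ∀ r, r < 7 ∨ 22 ≤ r → s'.reg r = s.reg r := by
  rw [lastProg]
  refine Runs.addSeq G.n (by rw [hs.size, hs.zero]; rfl) (by omega) ?_
  refine Runs.constSeq (by omega) ?_
  refine Runs.mono (T := G.n * (4 + 1) + 1)
    (Runs.loop (N := G.n) (fun i s' => s'.mem = s.mem ∧ s'.reg 17 = i ∧
      ((∀ a ∈ X, i ≤ a) ∧ s'.reg 21 = G.n ∨ ∃ a ∈ X, s'.reg 21 = a) ∧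
      ∀ r, r < 7 ∨ 22 ≤ r → s'.reg r = s.reg r) ?_ ?_ ?_) le_rfl ?_
  · rintro i s' ⟨-, h17, -, hf⟩
    exact ⟨h17, by rw [hf 0 (by omega), hs.size]⟩
  · rintro i s₁ hi ⟨hm, h17, h21, hf⟩
    have hs₁ : Setup G.n K s₁ := hs.of_eq fun r hr => hf r (Or.inl hr)
    refine Runs.loadSeq (if (⟨i, hi⟩ : Fin G.n) ∈ X then 1 else 0)
      (by rw [hm, h17]; exact hv.alive ⟨i, hi⟩) ?_
    refine Runs.seq (T := 1 + 1) (T' := 1) (Q := fun s' => s'.mem = s.mem ∧ s'.reg 17 = i ∧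
      ((∀ a ∈ X, i + 1 ≤ a) ∧ s'.reg 21 = G.n ∨ ∃ a ∈ X, s'.reg 21 = a) ∧
      ∀ r, r < 7 ∨ 22 ≤ r → s'.reg r = s.reg r) (Runs.ite ?_ ?_) ?_
    · intro hlt
      have hiX : (⟨i, hi⟩ : Fin G.n) ∈ X := by
        by_contra h
        simp [h] at hlt
      refine Runs.add i (by simp [h17, hs₁.zero]) (by omega) ⟨by simpa using hm, by simpa using h17,
        Or.inr ⟨_, hiX, by simp⟩, fun r hr => ?_⟩
      simp only [State.setReg_reg]
      repeat rw [if_neg (by omega)]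
      exact hf r hr
    · intro hlt
      have hiX : (⟨i, hi⟩ : Fin G.n) ∉ X := by
        intro h
        simp [h, hs₁.zero] at hlt
      refine Runs.skip ⟨by simpa using hm, by simpa using h17, ?_, fun r hr => ?_⟩
      · rcases h21 with ⟨h, h21⟩ | h
        · refine Or.inl ⟨fun a ha => ?_, by simpa using h21⟩
          have h1 := h a ha
          have h2 : (a : ℕ) ≠ i := fun e => hiX (by simp only [← e]; exact ha)
          omega
        · exact Or.inr (by simpa using h)
      · simp only [State.setReg_reg]
        repeat rw [if_neg (by omega)]
        exact hf r hr
    · rintro s₂ ⟨hm, h17, h21, hf⟩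
      have hs₂ : Setup G.n K s₂ := hs.of_eq fun r hr => hf r (Or.inl hr)
      refine Runs.add (i + 1) (by rw [h17, hs₂.one]) (by omega) ⟨by simpa using hm, by simp,
        by simpa using h21, fun r hr => ?_⟩
      simp only [State.setReg_reg]
      repeat rw [if_neg (by omega)]
      exact hf r hr
  · refine ⟨by simp, by simp, Or.inl ⟨fun a _ => Nat.zero_le _, by simp⟩, fun r hr => ?_⟩
    simp only [State.setReg_reg]
    repeat rw [if_neg (by omega)]
  · rintro s' ⟨hm, -, h21, hf⟩
    refine ⟨hm, ⟨?_, ?_⟩, hf⟩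
    · rintro rfl
      simpa using h21
    · rintro ⟨b, hb⟩
      rcases h21 with ⟨h, -⟩ | ⟨a, ha, h21⟩
      · exact absurd (h b hb) (by omega)
      · exact ⟨a, ha, h21, False.elim⟩

/-- Register `21` receives the vertex `reg 17` if `reg 18` is a near-twin of it. -/
def twinStepProg : Prog :=
  .load 14 18 ;; .ite 2 14 (.add 8 17 2 ;; .add 9 18 2 ;; distProg ;;
    .ite 10 6 (.add 21 17 2) .skip) .skip ;; .add 18 18 1

/-- Register `21` receives a vertex that has a near-twin, if there is one, and is unchanged
otherwise. -/
def twinProg : Prog :=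
  .add 7 4 2 ;; .const 17 0 ;; .loop 17 0 (.load 14 17 ;; .ite 2 14 (.const 18 0 ;;
    .loop 18 17 twinStepProg) .skip ;; .add 17 17 1)

/-- The state, relative to the state `s` before the search, once the pairs of `i` and the vertices
below `j` have been examined, and all pairs of vertices below `i`. -/
structure TwinState (G : BipGraph) (K : ℕ) (X : Finset (Fin G.n)) (s : State) (i : Fin G.n) (j : ℕ)
    (s' : State) : Prop where
  mem : s'.mem = s.mem
  inner : s'.reg 18 = j
  outer : s'.reg 17 = i
  mask : s'.reg 7 = G.n * G.n + G.n
  cand : IsCandidate G K X ((∃ a ∈ X, a < i ∧ HasTwin G.graph K X a) ∨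
    ∃ a' ∈ X, (a' : ℕ) < j ∧ traceDist G.graph X i a' ≤ K) (s'.reg 21)
  frame : ∀ r, r < 7 ∨ 22 ≤ r → s'.reg r = s.reg r

open Classical in
theorem runs_twinStepProg {W K : ℕ} {G : BipGraph} {X : Finset (Fin G.n)} {L : Fin G.n → ℕ}
    {s : State} (hs : Setup G.n K s) (hv : G.View X L s.mem)
    (hr : ∀ b : Fin G.n,
      s.mem (G.n * G.n + G.n + b) = if b ∈ traceReps G.graph X then 1 else 0)
    (hW : G.n * G.n + G.n + G.n + G.n ≤ W) (hW1 : 1 ≤ W) {i : Fin G.n} (hiX : i ∈ X) {j : Fin G.n}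
    (hj : j < i) {s₂ : State} (hs₂' : TwinState G K X s i j s₂) :
    Runs W twinStepProg s₂ (13 * G.n + 14) (TwinState G K X s i (j + 1)) := by
  have hin := i.2
  have hjn := j.2
  obtain ⟨hm, h18, h17, h7, hc, hf⟩ := hs₂'
  have hs₂ : Setup G.n K s₂ := hs.of_eq fun r hr => hf r (Or.inl hr)
  rw [twinStepProg]
  refine Runs.mono (T := (13 * G.n + 11 + 1) + 1 + 1) ?_ (by omega) fun _ h => h
  refine Runs.loadSeq (if j ∈ X then 1 else 0) (by rw [hm, h18]; exact hv.alive j) ?_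
  refine Runs.seq (T := 13 * G.n + 11 + 1) (T' := 1)
    (Q := fun s' => s'.mem = s.mem ∧ s'.reg 18 = j ∧ s'.reg 17 = i ∧
    s'.reg 7 = G.n * G.n + G.n ∧
    IsCandidate G K X ((∃ a ∈ X, a < i ∧ HasTwin G.graph K X a) ∨
      ∃ a' ∈ X, (a' : ℕ) < j + 1 ∧ traceDist G.graph X i a' ≤ K) (s'.reg 21) ∧
    ∀ r, r < 7 ∨ 22 ≤ r → s'.reg r = s.reg r) (Runs.ite ?_ ?_) ?_
  · intro hlt
    have hjX : j ∈ X := by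
      by_contra h
      simp [h] at hlt
    refine Runs.mono (T := (13 * G.n + 7 + (1 + 1)) + 1 + 1) ?_ (by omega) fun _ h => h
    refine Runs.addSeq i (by simp [h17, hs₂.zero]) (by omega) ?_
    refine Runs.addSeq j (by simp [h18, hs₂.zero]) (by omega) ?_
    refine Runs.seq (T := 13 * G.n + 7) (T' := 1 + 1) (runs_distProg_card (K := K) (X := X)
      (L := L) (B := G.n * G.n + G.n) ?_ ?_ hW ?_ le_rfl (traceReps G.graph X) ?_ i
      j ?_ ?_) ?_
    · refine hs₂.of_eq fun r hr => ?_
      simp only [State.setReg_reg]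
      repeat rw [if_neg (by omega)]
    · simpa [hm] using hv
    · simp [h7]
    · intro z
      simp [hm, hr]
    · simp
    · simp
    rintro s₃ ⟨hm₃, h10, hf₃⟩
    have hf₃' : ∀ r, r < 8 ∨ 17 ≤ r → s₃.reg r = s₂.reg r := by
      intro r hr
      rw [hf₃ r (by omega)]
      simp only [State.setReg_reg]
      repeat rw [if_neg (by omega)]
    have hm₃' : s₃.mem = s.mem := by rw [hm₃]; simpa using hm
    have hs₃ : Setup G.n K s₃ := hs₂.of_eq fun r hr => hf₃' r (by omega)
    have h17₃ : s₃.reg 17 = i := by rw [hf₃' 17 (by omega), h17]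
    have h18₃ : s₃.reg 18 = j := by rw [hf₃' 18 (by omega), h18]
    have h7₃ : s₃.reg 7 = G.n * G.n + G.n := by rw [hf₃' 7 (by omega), h7]
    have h10' : s₃.reg 10 = traceDist G.graph X i j := h10
    refine Runs.ite ?_ ?_
    · intro hlt
      rw [h10', hs₃.bound, Nat.lt_succ_iff] at hlt
      refine Runs.add i (by rw [h17₃, hs₃.zero]; rfl) (by omega) ⟨by simpa using hm₃',
        by simpa using h18₃, by simpa using h17₃, by simpa using h7₃,
        ⟨fun h => ?_, fun _ => ⟨i, hiX, by simp,
          fun _ => ⟨j, hjX, hj, hlt⟩⟩⟩, fun r hr => ?_⟩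
      · rw [h] at hiX
        simp at hiX
      · rw [State.setReg_reg, if_neg (by omega), hf₃' r (by omega), hf r hr]
    · intro hlt
      rw [h10', hs₃.bound, Nat.lt_succ_iff] at hlt
      refine Runs.skip ⟨hm₃', h18₃, h17₃, h7₃, ?_, fun r hr => ?_⟩
      · rw [hf₃' 21 (by omega)]
        refine ⟨hc.empty, fun hne => ?_⟩
        obtain ⟨a, ha, h21, hQ⟩ := hc.nonempty hne
        refine ⟨a, ha, h21, fun h => hQ (h.imp id ?_)⟩
        rintro ⟨a', ha', hlt', hd⟩
        refine ⟨a', ha', ?_, hd⟩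
        rcases Nat.lt_succ_iff_lt_or_eq.mp hlt' with h | h
        · exact h
        · rw [Fin.ext h] at hd
          exact absurd hd hlt
      · rw [hf₃' r (by omega), hf r hr]
  · intro hlt
    have hjX : j ∉ X := by
      intro h
      simp [h, hs₂.zero] at hlt
    refine (Runs.skip (Q := fun s' => _) ⟨by simpa using hm, by simpa using h18,
      by simpa using h17, by simpa using h7, ?_, fun r hr => ?_⟩).mono (by omega)
      fun _ h => h
    · simp only [State.setReg_reg, Nat.reduceEqDiff, if_false]
      refine ⟨hc.empty, fun hne => ?_⟩
      obtain ⟨a, ha, h21, hQ⟩ := hc.nonempty hne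
      refine ⟨a, ha, h21, fun h => hQ (h.imp id ?_)⟩
      rintro ⟨a', ha', hlt', hd⟩
      refine ⟨a', ha', ?_, hd⟩
      rcases Nat.lt_succ_iff_lt_or_eq.mp hlt' with h | h
      · exact h
      · exact absurd (by rwa [← Fin.ext h]) hjX
    · rw [State.setReg_reg, if_neg (by omega), hf r hr]
  · rintro s₃ ⟨hm, h18, h17, h7, hc, hf⟩
    have hs₃ : Setup G.n K s₃ := hs.of_eq fun r hr => hf r (Or.inl hr)
    refine Runs.add (j + 1) (by rw [h18, hs₃.one]) (by omega) ⟨by simpa using hm, by simp,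
      by simpa using h17, by simpa using h7, by simpa using hc, fun r hr => ?_⟩
    rw [State.setReg_reg, if_neg (by omega), hf r hr]

open Classical in
theorem runs_twinProg {W K : ℕ} {G : BipGraph} {X : Finset (Fin G.n)} {L : Fin G.n → ℕ}
    {s : State} (hs : Setup G.n K s) (hv : G.View X L s.mem)
    (hr : ∀ b : Fin G.n,
      s.mem (G.n * G.n + G.n + b) = if b ∈ traceReps G.graph X then 1 else 0)
    (hc : IsCandidate G K X False (s.reg 21))
    (hW : G.n * G.n + G.n + G.n + G.n ≤ W) (hW1 : 1 ≤ W) :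
    Runs W twinProg s (G.n * (G.n * (13 * G.n + 15) + 6) + 3) fun s' => s'.mem = s.mem ∧
      IsCandidate G K X (∃ a ∈ X, HasTwin G.graph K X a) (s'.reg 21) ∧
        ∀ r, r < 7 ∨ 22 ≤ r → s'.reg r = s.reg r := by
  rw [twinProg]
  refine Runs.addSeq (G.n * G.n + G.n) (by rw [hs.reps, hs.zero]; rfl) (by omega) ?_
  refine Runs.constSeq (by omega) ?_
  refine Runs.mono (T := G.n * (G.n * (13 * G.n + 15) + 5 + 1) + 1)
    (Runs.loop (N := G.n) (fun i s' => s'.mem = s.mem ∧ s'.reg 17 = i ∧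
      s'.reg 7 = G.n * G.n + G.n ∧
      IsCandidate G K X (∃ a ∈ X, (a : ℕ) < i ∧ HasTwin G.graph K X a) (s'.reg 21) ∧
      ∀ r, r < 7 ∨ 22 ≤ r → s'.reg r = s.reg r) ?_ ?_ ?_) le_rfl ?_
  · rintro i s' ⟨-, h17, -, -, hf⟩
    exact ⟨h17, by rw [hf 0 (by omega), hs.size]⟩
  · rintro i s₁ hi ⟨hm, h17, h7, hc, hf⟩
    have hs₁ : Setup G.n K s₁ := hs.of_eq fun r hr => hf r (Or.inl hr)
    obtain ⟨T, hT⟩ : ∃ T, T = G.n * (13 * G.n + 15) + 1 := ⟨_, rfl⟩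
    refine Runs.mono (T := T + 1 + 1 + 1 + 1) ?_ (by omega) fun _ h => h
    refine Runs.loadSeq (if (⟨i, hi⟩ : Fin G.n) ∈ X then 1 else 0)
      (by rw [hm, h17]; exact hv.alive ⟨i, hi⟩) ?_
    refine Runs.seq (T := T + 1 + 1) (T' := 1)
      (Q := fun s' => s'.mem = s.mem ∧ s'.reg 17 = i ∧ s'.reg 7 = G.n * G.n + G.n ∧
      IsCandidate G K X (∃ a ∈ X, (a : ℕ) < i + 1 ∧ HasTwin G.graph K X a) (s'.reg 21) ∧
      ∀ r, r < 7 ∨ 22 ≤ r → s'.reg r = s.reg r) (Runs.ite ?_ ?_) ?_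
    · intro hlt
      have hiX : (⟨i, hi⟩ : Fin G.n) ∈ X := by
        by_contra h
        simp [h] at hlt
      refine Runs.constSeq (by omega) ?_
      refine Runs.mono (T := i * (13 * G.n + 14 + 1) + 1) (Runs.loop (N := i)
        (TwinState G K X s ⟨i, hi⟩) (fun j s' h => ⟨h.inner, h.outer⟩) (fun j s₂ hj h =>
          runs_twinStepProg hs hv hr hW hW1 hiX (j := ⟨j, hj.trans hi⟩) hj h) ?_) ?_ ?_
      · refine ⟨by simpa using hm, by simp, by simpa using h17, by simpa using h7, ?_,
          fun r hr => ?_⟩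
        · simp only [State.setReg_reg, Nat.reduceEqDiff, if_false]
          refine ⟨hc.empty, fun hne => ?_⟩
          obtain ⟨a, ha, h21, hQ⟩ := hc.nonempty hne
          refine ⟨a, ha, h21, ?_⟩
          rintro (h | ⟨a', -, h, -⟩)
          · exact hQ h
          · exact absurd h (Nat.not_lt_zero _)
        · simp only [State.setReg_reg]
          repeat rw [if_neg (by omega)]
          exact hf r hr
      · have : i * (13 * G.n + 14 + 1) ≤ G.n * (13 * G.n + 15) := Nat.mul_le_mul hi.le le_rfl
        omega
      · rintro s₂ ⟨hm, -, h17, h7, hc, hf⟩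
        refine ⟨hm, h17, h7, ⟨hc.empty, fun hne => ?_⟩, hf⟩
        obtain ⟨a, ha, h21, hQ⟩ := hc.nonempty hne
        refine ⟨a, ha, h21, ?_⟩
        rintro ⟨a₁, ha₁, hlt₁, a', ha', hlt', hd⟩
        refine hQ ?_
        rcases Nat.lt_succ_iff_lt_or_eq.mp hlt₁ with h | rfl
        · exact Or.inl ⟨a₁, ha₁, h, a', ha', hlt', hd⟩
        · exact Or.inr ⟨a', ha', hlt', hd⟩
    · intro hlt
      have hiX : (⟨i, hi⟩ : Fin G.n) ∉ X := by
        intro h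
        simp [h, hs₁.zero] at hlt
      refine (Runs.skip (Q := fun s' => _) ⟨by simpa using hm, by simpa using h17,
        by simpa using h7, ?_, fun r hr => ?_⟩).mono (by omega) fun _ h => h
      · simp only [State.setReg_reg, Nat.reduceEqDiff, if_false]
        refine ⟨hc.empty, fun hne => ?_⟩
        obtain ⟨a, ha, h21, hQ⟩ := hc.nonempty hne
        refine ⟨a, ha, h21, ?_⟩
        rintro ⟨a₁, ha₁, hlt₁, htwin⟩
        refine hQ ⟨a₁, ha₁, ?_, htwin⟩
        rcases Nat.lt_succ_iff_lt_or_eq.mp hlt₁ with h | h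
        · exact h
        · exact absurd (by simp only [← h]; exact ha₁) hiX
      · rw [State.setReg_reg, if_neg (by omega), hf r hr]
    · rintro s₂ ⟨hm, h17, h7, hc, hf⟩
      have hs₂ : Setup G.n K s₂ := hs.of_eq fun r hr => hf r (Or.inl hr)
      refine Runs.add (i + 1) (by rw [h17, hs₂.one]) (by omega) ⟨by simpa using hm, by simp,
        by simpa using h7, by simpa using hc, fun r hr => ?_⟩
      rw [State.setReg_reg, if_neg (by omega), hf r hr]
  · refine ⟨by simp, by simp, by simp, ?_, fun r hr => ?_⟩
    · simpa using hc
    · simp only [State.setReg_reg]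
      repeat rw [if_neg (by omega)]
  · rintro s' ⟨hm, -, -, hc, hf⟩
    refine ⟨hm, ⟨hc.empty, fun hne => ?_⟩, hf⟩
    obtain ⟨a, ha, h21, hQ⟩ := hc.nonempty hne
    exact ⟨a, ha, h21, fun ⟨a₁, ha₁, h⟩ => hQ ⟨a₁, ha₁, a₁.2, h⟩⟩

/-! ### Removing a vertex -/

/-- Removes the vertex in register `21`, if it is one, and labels its neighbors with its
successor. -/
def removeProg : Prog :=
  .ite 21 0 (.store 21 2 ;; .mul 11 21 0 ;; .add 11 11 0 ;; .add 12 21 1 ;; .const 17 0 ;;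
    .loop 17 0 (.add 14 11 17 ;; .load 14 14 ;; .ite 2 14 (.add 14 5 17 ;; .store 14 12) .skip ;;
      .add 17 17 1)) .skip

open Classical in
theorem runs_removeProg {W K : ℕ} {G : BipGraph} {X : Finset (Fin G.n)} {L : Fin G.n → ℕ}
    {s : State} (hs : Setup G.n K s) (hv : G.View X L s.mem) {a : Fin G.n} (ha : s.reg 21 = a)
    (hW : G.n * G.n + G.n + G.n + G.n ≤ W) (hW1 : 1 ≤ W) :
    Runs W removeProg s (G.n * 7 + 7) fun s' =>
      G.View (X.erase a) (fun b => if G.graph.Adj a b then a + 1 else L b) s'.mem ∧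
        ∀ r, r < 7 ∨ 22 ≤ r → s'.reg r = s.reg r := by
  have hrow := row_add_lt a.2
  have han := a.2
  rw [removeProg]
  refine Runs.mono (T := G.n * 7 + 6 + 1) (Runs.ite (fun _ => ?_) fun h => ?_) le_rfl fun _ h => h
  swap
  · rw [ha, hs.size] at h
    exact absurd a.2 h
  refine Runs.storeSeq a 0 ha hs.zero ?_
  refine Runs.mulSeq (a * G.n) (by simp [ha, hs.size]) (by omega) ?_
  refine Runs.addSeq (a * G.n + G.n) (by simp [hs.size]) (by omega) ?_
  refine Runs.addSeq (a + 1) (by simp [ha, hs.one]) (by omega) ?_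
  refine Runs.constSeq (by omega) ?_
  refine Runs.mono (T := G.n * (6 + 1) + 1)
    (Runs.loop (N := G.n) (fun i s' => G.View (X.erase a)
      (fun b => if G.graph.Adj a b ∧ (b : ℕ) < i then a + 1 else L b) s'.mem ∧ s'.reg 17 = i ∧
      s'.reg 11 = a * G.n + G.n ∧ s'.reg 12 = a + 1 ∧
      ∀ r, r < 7 ∨ 22 ≤ r → s'.reg r = s.reg r) ?_ ?_ ?_) le_rfl ?_
  · rintro i s' ⟨-, h17, -, -, hf⟩
    exact ⟨h17, by rw [hf 0 (by omega), hs.size]⟩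
  · rintro i s₁ hi ⟨hv₁, h17, h11, h12, hf⟩
    have hs₁ : Setup G.n K s₁ := hs.of_eq fun r hr => hf r (Or.inl hr)
    refine Runs.addSeq (a * G.n + G.n + i) (by rw [h11, h17]) (by omega) ?_
    refine Runs.loadSeq (if G.graph.Adj a ⟨i, hi⟩ then 1 else 0)
      (by simpa using hv₁.adj a ⟨i, hi⟩) ?_
    refine Runs.seq (T := 1 + 1 + 1) (T' := 1) (Q := fun s' => G.View (X.erase a)
      (fun b => if G.graph.Adj a b ∧ (b : ℕ) < i + 1 then a + 1 else L b) s'.mem ∧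
      s'.reg 17 = i ∧ s'.reg 11 = a * G.n + G.n ∧ s'.reg 12 = a + 1 ∧
      ∀ r, r < 7 ∨ 22 ≤ r → s'.reg r = s.reg r) (Runs.ite ?_ ?_) ?_
    · intro hlt
      have hai : G.graph.Adj a ⟨i, hi⟩ := by
        by_contra h
        simp [h] at hlt
      refine Runs.addSeq (G.n * G.n + G.n + G.n + i) (by simp [h17, hs₁.labels]) (by omega) ?_
      refine Runs.store (G.n * G.n + G.n + G.n + i) (a + 1) (by simp) (by simp [h12])
        ⟨⟨fun v => ?_, fun u v => ?_, fun v => ?_⟩, by simpa using h17, by simpa using h11,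
          by simpa using h12, fun r hr => ?_⟩
      · simp only [State.setReg_mem, State.setMem_mem]
        rw [if_neg (by omega), hv₁.alive]
      · simp only [State.setReg_mem, State.setMem_mem]
        have := row_add_lt u.2
        rw [if_neg (by omega), hv₁.adj]
      · simp only [State.setReg_mem, State.setMem_mem]
        by_cases hvi : (v : ℕ) = i
        · have hav : G.graph.Adj a v := by
            have : v = ⟨i, hi⟩ := Fin.ext hvi
            rwa [this]
          rw [if_pos (by omega), if_pos ⟨hav, by omega⟩]
        · rw [if_neg (by omega), hv₁.label]
          congr 1
          rw [eq_iff_iff]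
          constructor <;> rintro ⟨h1, h2⟩ <;> exact ⟨h1, by omega⟩
      · simp only [State.setReg_reg, State.setMem_reg]
        repeat rw [if_neg (by omega)]
        exact hf r hr
    · intro hlt
      have hai : ¬ G.graph.Adj a ⟨i, hi⟩ := by
        intro h
        simp [h, hs₁.zero] at hlt
      refine (Runs.skip (Q := fun s' => _) ⟨⟨hv₁.alive, hv₁.adj, fun v => ?_⟩, by simpa using h17,
        by simpa using h11, by simpa using h12, fun r hr => ?_⟩).mono (by omega) fun _ h => h
      · rw [State.setReg_mem, State.setReg_mem, hv₁.label]
        congr 1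
        rw [eq_iff_iff]
        constructor <;> rintro ⟨h1, h2⟩ <;> refine ⟨h1, ?_⟩
        · omega
        · have : (v : ℕ) ≠ i := by
            rintro rfl
            exact hai h1
          omega
      · simp only [State.setReg_reg]
        repeat rw [if_neg (by omega)]
        exact hf r hr
    · rintro s₂ ⟨hv₂, h17, h11, h12, hf⟩
      have hs₂ : Setup G.n K s₂ := hs.of_eq fun r hr => hf r (Or.inl hr)
      refine Runs.add (i + 1) (by rw [h17, hs₂.one]) (by omega) ⟨by simpa using hv₂, by simp,
        by simpa using h11, by simpa using h12, fun r hr => ?_⟩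
      rw [State.setReg_reg, if_neg (by omega), hf r hr]
  · refine ⟨⟨fun v => ?_, fun u v => ?_, fun v => ?_⟩, by simp, by simp, by simp,
      fun r hr => ?_⟩
    · simp only [State.setReg_mem, State.setMem_mem]
      rw [hv.alive]
      by_cases h : v = a
      · simp [h]
      · simp [h, Fin.val_inj]
    · simp only [State.setReg_mem, State.setMem_mem]
      rw [if_neg (by omega), hv.adj]
    · simp only [State.setReg_mem, State.setMem_mem]
      rw [if_neg (by omega), hv.label]
      simp
    · simp only [State.setReg_reg, State.setMem_reg]
      repeat rw [if_neg (by omega)]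
  · rintro s' ⟨hv', -, -, -, hf⟩
    refine ⟨⟨hv'.alive, hv'.adj, fun v => ?_⟩, hf⟩
    rw [hv'.label]
    simp

theorem runs_removeProg_of_not_lt {W n K : ℕ} {s : State} (hs : Setup n K s) (h : s.reg 21 = n) :
    Runs W removeProg s 2 fun s' => s' = s := by
  rw [removeProg]
  refine Runs.mono (T := 1 + 1) (Q := fun s' => s' = s) ?_ le_rfl fun _ h => h
  obtain ⟨t, s', he, ht, hs'⟩ := Runs.skip (W := W) (s := s) (Q := fun s' => s' = s) rfl
  exact ⟨t + 1, s', .ite_false (by rw [h, hs.size]; omega) he, by omega, hs'⟩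

/-! ### Writing the output -/

/-- Numbers the labels in use and writes the parts and the leaders. A label is the successor of a
vertex. -/
def outputProg : Prog :=
  .const 23 0 ;; .const 17 0 ;; .loop 17 0 (.const 19 0 ;; .add 20 17 1 ;; .const 18 0 ;;
    .loop 18 0 (.add 14 5 18 ;; .load 14 14 ;;
      .ite 14 20 .skip (.ite 20 14 .skip (.store 18 23 ;; .const 19 1)) ;; .add 18 18 1) ;;
    .add 14 0 23 ;; .store 14 17 ;; .add 23 23 19 ;; .add 17 17 1) ;; .add 0 23 2

/-- The state, relative to the state `s` before, once the labels below `i + 1` have been treated,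
and the label `i + 1` for the vertices below `j`. Here `U` is the set of all `a` such that `a + 1`
is a label. -/
structure OutputState {n : ℕ} (L : Fin n → ℕ) (U : ℕ → Prop) [DecidablePred U] (s : State)
    (i j : ℕ) (s' : State) : Prop where
  label : ∀ b : Fin n, s'.mem (n * n + n + n + b) = L b
  part : ∀ b : Fin n, ∀ a, L b = a + 1 → (a < i ∨ a = i ∧ (b : ℕ) < j) →
    s'.mem b = Nat.count U a
  leader : ∀ a < i, U a → s'.mem (n + Nat.count U a) = a
  outer : s'.reg 17 = i
  count : s'.reg 23 = Nat.count U i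
  frame : ∀ r, r < 7 → s'.reg r = s.reg r

theorem runs_outputProg_inner {W n K : ℕ} {L : Fin n → ℕ} {U : ℕ → Prop} [DecidablePred U]
    {s : State} (hs : Setup n K s) (hW : n * n + n + n + n ≤ W) (hW1 : 1 ≤ W) {i : ℕ} (hi : i < n)
    {s₁ : State} (h19 : s₁.reg 19 = 0) (h20 : s₁.reg 20 = i + 1) (h18 : s₁.reg 18 = 0)
    (h : OutputState L U s i 0 s₁) :
    Runs W (.loop 18 0 (.add 14 5 18 ;; .load 14 14 ;;
      .ite 14 20 .skip (.ite 20 14 .skip (.store 18 23 ;; .const 19 1)) ;; .add 18 18 1))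
      s₁ (n * 8 + 1) fun s' => OutputState L U s i n s' ∧
        (s'.reg 19 = 0 ∧ (∀ b, L b ≠ i + 1) ∨ s'.reg 19 = 1 ∧ ∃ b, L b = i + 1) := by
  refine Runs.mono (T := n * (7 + 1) + 1) (Runs.loop (N := n) (fun j s' =>
    (OutputState L U s i j s' ∧ (s'.reg 19 = 0 ∧ (∀ b : Fin n, (b : ℕ) < j → L b ≠ i + 1) ∨
      s'.reg 19 = 1 ∧ ∃ b, L b = i + 1)) ∧ s'.reg 18 = j ∧ s'.reg 20 = i + 1) ?_ ?_ ?_) le_rfl ?_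
  · rintro j s' ⟨⟨h, -⟩, h18, -⟩
    exact ⟨h18, by rw [h.frame 0 (by omega), hs.size]⟩
  · rintro j s₂ hj ⟨⟨h, h19⟩, h18, h20⟩
    have hs₂ : Setup n K s₂ := hs.of_eq h.frame
    have hlast : ∀ b : Fin n, (b : ℕ) < j + 1 → (b : ℕ) < j ∨ b = ⟨j, hj⟩ := by
      intro b hb
      rcases Nat.lt_succ_iff_lt_or_eq.mp hb with h | h
      · exact Or.inl h
      · exact Or.inr (Fin.ext h)
    refine Runs.addSeq (n * n + n + n + j) (by rw [hs₂.labels, h18]) (by omega) ?_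
    refine Runs.loadSeq (L ⟨j, hj⟩) (by simpa using h.label ⟨j, hj⟩) ?_
    -- If the label of `j` is not `i + 1`, then nothing is to be done.
    have hskip : L ⟨j, hj⟩ ≠ i + 1 →
        (OutputState L U s i (j + 1) ((s₂.setReg 14 (n * n + n + n + j)).setReg 14 (L ⟨j, hj⟩)) ∧
        (s₂.reg 19 = 0 ∧ (∀ b : Fin n, (b : ℕ) < j + 1 → L b ≠ i + 1) ∨
          s₂.reg 19 = 1 ∧ ∃ b, L b = i + 1)) := by
      intro hne
      refine ⟨⟨h.label, ?_, h.leader, by simpa using h.outer, by simpa using h.count, ?_⟩, ?_⟩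
      · rintro b a hb (ha | ⟨rfl, hlt⟩)
        · exact h.part b a hb (Or.inl ha)
        · rcases hlast b hlt with hlt | rfl
          · exact h.part b a hb (Or.inr ⟨rfl, hlt⟩)
          · exact absurd hb hne
      · intro r hr
        simp only [State.setReg_reg]
        repeat rw [if_neg (by omega)]
        exact h.frame r hr
      · refine h19.imp (fun ⟨h0, hb⟩ => ⟨h0, fun b hlt => ?_⟩) id
        rcases hlast b hlt with hlt | rfl
        · exact hb b hlt
        · exact hne
    refine Runs.seq (T := 2 + 1 + 1) (T' := 1) (Q := fun s' => (OutputState L U s i (j + 1) s' ∧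
      (s'.reg 19 = 0 ∧ (∀ b : Fin n, (b : ℕ) < j + 1 → L b ≠ i + 1) ∨
      s'.reg 19 = 1 ∧ ∃ b, L b = i + 1)) ∧ s'.reg 18 = j ∧ s'.reg 20 = i + 1)
      (Runs.ite (fun hlt => ?_) fun hlt => Runs.ite (fun hlt' => ?_) fun hlt' => ?_) ?_
    · have hne : L ⟨j, hj⟩ ≠ i + 1 := by
        intro e
        simp [h20, e] at hlt
      refine (Runs.skip (Q := fun s' => _) ⟨⟨(hskip hne).1, by simpa using (hskip hne).2⟩,
        by simpa using h18, by simpa using h20⟩).mono (by omega) fun _ h => h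
    · have hne : L ⟨j, hj⟩ ≠ i + 1 := by
        intro e
        simp [h20, e] at hlt'
      refine (Runs.skip (Q := fun s' => _) ⟨⟨(hskip hne).1, by simpa using (hskip hne).2⟩,
        by simpa using h18, by simpa using h20⟩).mono (by omega) fun _ h => h
    · have he : L ⟨j, hj⟩ = i + 1 := by
        simp [h20] at hlt hlt'
        omega
      refine Runs.storeSeq j (Nat.count U i) (by simp [h18]) (by simp [h.count]) ?_
      refine Runs.const (by omega) ⟨⟨⟨fun b => ?_, fun b a hb hlt => ?_, fun a ha hUa => ?_,
        by simpa using h.outer, by simpa using h.count, fun r hr => ?_⟩, ?_⟩,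
        by simpa using h18, by simpa using h20⟩
      · simp only [State.setReg_mem, State.setMem_mem]
        rw [if_neg (by omega), h.label]
      · simp only [State.setReg_mem, State.setMem_mem]
        split_ifs with hbj
        · have : b = ⟨j, hj⟩ := Fin.ext hbj
          subst this
          obtain rfl : a = i := by omega
          rfl
        · refine h.part b a hb (hlt.imp id fun ⟨e, hlt⟩ => ⟨e, ?_⟩)
          omega
      · simp only [State.setReg_mem, State.setMem_mem]
        rw [if_neg (by omega), h.leader a ha hUa]
      · simp only [State.setReg_reg, State.setMem_reg]
        repeat rw [if_neg (by omega)]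
        exact h.frame r hr
      · exact Or.inr ⟨by simp, _, he⟩
    · rintro s₃ ⟨⟨h, h19⟩, h18, h20⟩
      have hs₃ : Setup n K s₃ := hs.of_eq h.frame
      refine Runs.add (j + 1) (by rw [h18, hs₃.one]) (by omega)
        ⟨⟨⟨h.label, h.part, h.leader, by simpa using h.outer, by simpa using h.count,
          fun r hr => ?_⟩, by simpa using h19⟩, by simp, by simpa using h20⟩
      rw [State.setReg_reg, if_neg (by omega), h.frame r hr]
  · exact ⟨⟨h, Or.inl ⟨h19, fun b hb => absurd hb (Nat.not_lt_zero _)⟩⟩, h18, h20⟩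
  · rintro s' ⟨⟨h, h19⟩, -, -⟩
    exact ⟨h, h19.imp (fun ⟨h0, hb⟩ => ⟨h0, fun b => hb b b.2⟩) id⟩

theorem runs_outputProg {W n K : ℕ} {L : Fin n → ℕ} {U : ℕ → Prop} [DecidablePred U]
    (hU : ∀ a, U a ↔ ∃ b, L b = a + 1) {s : State} (hs : Setup n K s)
    (hL : ∀ b : Fin n, s.mem (n * n + n + n + b) = L b) (hW : n * n + n + n + n ≤ W)
    (hW1 : 1 ≤ W) :
    Runs W outputProg s (n * (n * 8 + 9) + 4) fun s' => s'.reg 0 = Nat.count U n ∧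
      (∀ b : Fin n, ∀ a < n, L b = a + 1 → s'.mem b = Nat.count U a) ∧
        ∀ a < n, U a → s'.mem (n + Nat.count U a) = a := by
  have hcount : ∀ a, Nat.count U a ≤ a := fun a => Nat.count_le U
  obtain ⟨T, hT⟩ : ∃ T, T = n * 8 + 8 := ⟨_, rfl⟩
  rw [outputProg]
  obtain ⟨T₁, hT₁⟩ : ∃ T₁, T₁ = n * (T + 1) + 1 := ⟨_, rfl⟩
  refine Runs.mono (T := T₁ + 1 + 1 + 1) ?_ (by rw [hT₁, hT]) fun _ h => h
  refine Runs.constSeq (by omega) ?_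
  refine Runs.constSeq (by omega) ?_
  rw [hT₁]
  refine Runs.seq (T := n * (T + 1) + 1) (T' := 1)
    (Runs.loop (N := n) (fun i s' => OutputState L U s i 0 s') ?_ ?_ ?_) ?_
  · rintro i s' h
    exact ⟨h.outer, by rw [h.frame 0 (by omega), hs.size]⟩
  · rintro i s₁ hi h
    have hs₁ : Setup n K s₁ := hs.of_eq h.frame
    obtain ⟨T₂, hT₂⟩ : ∃ T₂, T₂ = n * 8 + 1 := ⟨_, rfl⟩
    refine Runs.mono (T := T₂ + 4 + 1 + 1 + 1) ?_ (by omega) fun _ h => h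
    refine Runs.constSeq (by omega) ?_
    refine Runs.addSeq (i + 1) (by simp [h.outer, hs₁.one]) (by omega) ?_
    refine Runs.constSeq (by omega) ?_
    rw [hT₂]
    refine Runs.seq (T := n * 8 + 1) (T' := 4) (runs_outputProg_inner (L := L) (U := U) hs hW hW1 hi
      (by simp) (by simp) (by simp) ⟨h.label, h.part, h.leader, by simpa using h.outer,
        by simpa using h.count, fun r hr => ?_⟩) ?_
    · simp only [State.setReg_reg]
      repeat rw [if_neg (by omega)]
      exact h.frame r hr
    rintro s₂ ⟨h, h19⟩
    have hs₂ : Setup n K s₂ := hs.of_eq h.frame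
    have hci := hcount i
    refine Runs.addSeq (n + Nat.count U i) (by rw [hs₂.size, h.count]) (by omega) ?_
    refine Runs.storeSeq (n + Nat.count U i) i (by simp) (by simp [h.outer]) ?_
    refine Runs.addSeq (Nat.count U (i + 1)) ?_ ((hcount _).trans (by omega)) ?_
    · rw [Nat.count_succ]
      rcases h19 with ⟨h0, hb⟩ | ⟨h0, hb⟩
      · rw [if_neg (by rw [hU]; rintro ⟨b, hb'⟩; exact hb b hb')]
        simp [h.count, h0]
      · rw [if_pos ((hU i).mpr hb)]
        simp [h.count, h0]
    refine Runs.add (i + 1) (by simp [h.outer, hs₂.one]) (by omega)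
      ⟨fun b => ?_, fun b a hb hlt => ?_, fun a ha hUa => ?_, by simp, by simp, fun r hr => ?_⟩
    · simp only [State.setReg_mem, State.setMem_mem]
      rw [if_neg (by omega), h.label]
    · simp only [State.setReg_mem, State.setMem_mem]
      rw [if_neg (by omega), h.part b a hb (by omega)]
    · simp only [State.setReg_mem, State.setMem_mem]
      rcases Nat.lt_succ_iff_lt_or_eq.mp ha with ha | rfl
      · have := Nat.count_strict_mono hUa ha
        rw [if_neg (by omega), h.leader a ha hUa]
      · rw [if_pos rfl]
    · simp only [State.setReg_reg, State.setMem_reg]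
      repeat rw [if_neg (by omega)]
      exact h.frame r hr
  · refine ⟨by simpa using hL, fun b a _ h => absurd h (by omega), fun a ha => absurd ha (by omega),
      by simp, by simp, fun r hr => ?_⟩
    simp only [State.setReg_reg]
    repeat rw [if_neg (by omega)]
  · intro s₁ h
    have hs₁ : Setup n K s₁ := hs.of_eq h.frame
    have := hcount n
    refine Runs.add (Nat.count U n) (by rw [h.count, hs₁.zero]; rfl) (by omega)
      ⟨by simp, fun b a ha hb => by simpa using h.part b a hb (Or.inl ha),
        fun a ha hUa => by simpa using h.leader a ha hUa⟩

/-! ### The elimination -/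

open Classical in
/-- The situation after `j` rounds of the elimination of `A`: `X` is the set of vertices left, `τ`
is the round of the removal (or the number of vertices, for a vertex that is left), and `L b` is the
successor of the neighbor of `b` removed last, or zero if there is none. -/
structure EliminationState {n : ℕ} (G : SimpleGraph (Fin n)) (A : Finset (Fin n)) (K j : ℕ)
    (τ : Fin n → ℕ) (X : Finset (Fin n)) (L : Fin n → ℕ) : Prop where
  mem_iff : ∀ a, a ∈ X ↔ a ∈ A ∧ τ a = n
  lt : ∀ a ∈ A, a ∉ X → τ a < j
  card : X.card + j ≤ n
  injOn : ∀ a ∈ A, ∀ a' ∈ A, a ∉ X → τ a = τ a' → a = a'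
  twin : ∀ a ∈ A, a ∉ X → (∀ x ∈ A, τ a ≤ τ x → x = a) ∨
    ∃ a' ∈ A, τ a < τ a' ∧ traceDist G (A.filter fun x => τ a ≤ τ x) a a' ≤ K
  label : ∀ b, (L b = 0 ∧ ∀ a ∈ A, G.Adj a b → a ∈ X) ∨
    ∃ a ∈ A, a ∉ X ∧ G.Adj a b ∧ L b = a + 1 ∧ ∀ a' ∈ A, G.Adj a' b → a' ∉ X → τ a' ≤ τ a

theorem EliminationState.start {n : ℕ} (G : SimpleGraph (Fin n)) (A : Finset (Fin n)) (K : ℕ) :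
    EliminationState G A K 0 (fun _ => n) A fun _ => 0 where
  mem_iff a := by simp
  lt a ha h := absurd ha h
  card := by simpa using Finset.card_le_univ A
  injOn a ha a' _ h := absurd ha h
  twin a ha h := absurd ha h
  label b := Or.inl ⟨rfl, fun a ha _ => ha⟩

theorem EliminationState.skip {n : ℕ} {G : SimpleGraph (Fin n)} {A : Finset (Fin n)} {K j : ℕ}
    {τ : Fin n → ℕ} {L : Fin n → ℕ} (h : EliminationState G A K j τ ∅ L) (hj : j < n) :
    EliminationState G A K (j + 1) τ ∅ L where
  mem_iff := h.mem_iff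
  lt a ha hX := (h.lt a ha hX).trans (Nat.lt_succ_self j)
  card := by simpa using hj
  injOn := h.injOn
  twin := h.twin
  label := h.label

open Classical in
theorem EliminationState.remove {n : ℕ} {G : SimpleGraph (Fin n)} {A X : Finset (Fin n)} {K j : ℕ}
    {τ : Fin n → ℕ} {L : Fin n → ℕ} (h : EliminationState G A K j τ X L) (hj : j < n) {a : Fin n}
    (ha : a ∈ X) (hcard : 2 ≤ X.card → HasTwin G K X a) :
    EliminationState G A K (j + 1) (Function.update τ a j) (X.erase a)
      fun b => if G.Adj a b then a + 1 else L b := by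
  have hA : ∀ x ∈ X, x ∈ A := fun x hx => ((h.mem_iff x).mp hx).1
  have hτX : ∀ x ∈ X, τ x = n := fun x hx => ((h.mem_iff x).mp hx).2
  have hdead : ∀ x ∈ A, x ∉ X.erase a → x = a ∨ x ≠ a ∧ x ∉ X := by
    intro x _ hx
    rw [Finset.mem_erase] at hx
    tauto
  have hτa : Function.update τ a j a = j := Function.update_self _ _ _
  have hτ : ∀ x, x ≠ a → Function.update τ a j x = τ x :=
    fun x hx => Function.update_of_ne hx _ _
  -- At the time of its removal, the vertices that are not removed earlier are those of `X`.
  have hset : (A.filter fun x => j ≤ Function.update τ a j x) = X := by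
    ext x
    rw [Finset.mem_filter]
    by_cases hxa : x = a
    · subst hxa
      simp [hA x ha, ha]
    · rw [hτ x hxa]
      constructor
      · rintro ⟨hx, hle⟩
        by_contra hxX
        exact absurd (h.lt x hx hxX) (not_lt.mpr hle)
      · intro hx
        exact ⟨hA x hx, by rw [hτX x hx]; exact hj.le⟩
  -- For a vertex removed before, nothing changes.
  have hearly : ∀ d ∈ A, d ∉ X → ∀ x, (τ d ≤ Function.update τ a j x ↔ τ d ≤ τ x) := by
    intro d hd hdX x
    have hlt := h.lt d hd hdX
    by_cases hxa : x = a
    · rw [hxa, hτa, hτX a ha]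
      constructor <;> intro <;> omega
    · rw [hτ x hxa]
  refine ⟨fun x => ?_, fun x hx hxX => ?_, ?_, fun x hx y hy hxX hxy => ?_, fun x hx hxX => ?_,
    fun b => ?_⟩
  · rw [Finset.mem_erase, h.mem_iff]
    by_cases hxa : x = a
    · subst hxa
      simp [hj.ne]
    · simp [hxa]
  · rcases hdead x hx hxX with rfl | ⟨hxa, hxX⟩
    · rw [hτa]
      exact Nat.lt_succ_self j
    · rw [hτ x hxa]
      exact (h.lt x hx hxX).trans (Nat.lt_succ_self j)
  · have := Finset.card_erase_add_one ha
    have := h.card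
    omega
  · rcases hdead x hx hxX with rfl | ⟨hxa, hxX⟩
    · by_contra hne
      rw [hτa, hτ y (Ne.symm hne)] at hxy
      by_cases hyX : y ∈ X
      · rw [hτX y hyX] at hxy
        omega
      · have := h.lt y hy hyX
        omega
    · rw [hτ x hxa] at hxy
      by_cases hya : y = a
      · rw [hya, hτa] at hxy
        have := h.lt x hx hxX
        omega
      · rw [hτ y hya] at hxy
        exact h.injOn x hx y hy hxX hxy
  · rcases hdead x hx hxX with rfl | ⟨hxa, hxX⟩
    · rw [hτa, hset]
      by_cases hc : 2 ≤ X.card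
      · obtain ⟨a', ha', hlt, hd⟩ := hcard hc
        refine Or.inr ⟨a', hA a' ha', ?_, hd⟩
        rw [hτ a' hlt.ne, hτX a' ha']
        exact hj
      · refine Or.inl fun y hy hle => ?_
        have hyX : y ∈ X := by
          rw [← hset]
          exact Finset.mem_filter.mpr ⟨hy, hle⟩
        exact Finset.card_le_one.mp (by omega) y hyX x ha
    · rw [hτ x hxa]
      simp only [hearly x hx hxX]
      refine (h.twin x hx hxX).imp id ?_
      rintro ⟨a', ha', hlt, hd⟩
      refine ⟨a', ha', ?_, hd⟩
      by_cases ha'a : a' = a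
      · rw [ha'a, hτa]
        exact h.lt x hx hxX
      · rwa [hτ a' ha'a]
  · by_cases hab : G.Adj a b
    · refine Or.inr ⟨a, hA a ha, by simp, hab, by simp [hab], fun a' ha' _ ha'X => ?_⟩
      rw [hτa]
      rcases hdead a' ha' ha'X with rfl | ⟨hne, ha'X⟩
      · rw [hτa]
      · rw [hτ a' hne]
        exact (h.lt a' ha' ha'X).le
    · simp only [if_neg hab]
      rcases h.label b with ⟨h0, hb⟩ | ⟨a₁, ha₁, ha₁X, hadj, hL, hmax⟩
      · refine Or.inl ⟨h0, fun x hx hxb => Finset.mem_erase.mpr ⟨?_, hb x hx hxb⟩⟩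
        rintro rfl
        exact hab hxb
      · have hne₁ : a₁ ≠ a := fun e => ha₁X (e ▸ ha)
        refine Or.inr ⟨a₁, ha₁, fun hX => ha₁X (Finset.mem_of_mem_erase hX), hadj, hL,
          fun x hx hxb hxX => ?_⟩
        rcases hdead x hx hxX with rfl | ⟨hne, hxX⟩
        · exact absurd hxb hab
        · rw [hτ x hne, hτ a₁ hne₁]
          exact hmax x hx hxb hxX

/-- One round of the elimination. -/
def roundProg : Prog :=
  repsProg ;; lastProg ;; twinProg ;; removeProg ;; .add 22 22 1

/-- Eliminates the left side and writes the parts and their leaders. -/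
def leaderProg (K : ℕ) : Prog :=
  .const 1 1 ;; .const 2 0 ;; .mul 3 0 0 ;; .add 4 3 0 ;; .add 5 4 0 ;; .const 6 (K + 1) ;;
    .const 22 0 ;; .loop 22 0 roundProg ;; outputProg

/-- Bound on the number of steps of one round. -/
def roundTime (n : ℕ) : ℕ :=
  (n * (n * (13 * n + 13) + 7) + 3) + ((n * 5 + 3) + ((n * (n * (13 * n + 15) + 6) + 3) +
    ((n * 7 + 7) + 1)))

theorem runs_roundProg {W K : ℕ} {G : BipGraph} {A X : Finset (Fin G.n)} {L τ : Fin G.n → ℕ}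
    {s : State} {j : ℕ} (hj : j < G.n) (hs : Setup G.n K s) (hv : G.View X L s.mem)
    (h22 : s.reg 22 = j) (hX : EliminationState G.graph A K j τ X L)
    (htwin : ∀ X : Finset (Fin G.n), 2 ≤ X.card → ∃ a ∈ X, HasTwin G.graph K X a)
    (hW : G.n * G.n + G.n + G.n + G.n ≤ W) (hW1 : 1 ≤ W) :
    Runs W roundProg s (roundTime G.n) fun s' => Setup G.n K s' ∧ s'.reg 22 = j + 1 ∧
      ∃ τ X L, G.View X L s'.mem ∧ EliminationState G.graph A K (j + 1) τ X L := by
  classical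
  rw [roundProg, roundTime]
  refine Runs.seq (runs_repsProg hs hv hW hW1) ?_
  rintro s₁ ⟨hv₁, hr, hf₁⟩
  have hs₁ : Setup G.n K s₁ := hs.of_eq fun r hr => hf₁ r (Or.inl hr)
  refine Runs.seq (runs_lastProg hs₁ hv₁ hW hW1) ?_
  rintro s₂ ⟨hm₂, hc₂, hf₂⟩
  have hs₂ : Setup G.n K s₂ := hs₁.of_eq fun r hr => hf₂ r (Or.inl hr)
  rw [← hm₂] at hv₁ hr
  refine Runs.seq (runs_twinProg hs₂ hv₁ hr hc₂ hW hW1) ?_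
  rintro s₃ ⟨hm₃, hc₃, hf₃⟩
  have hs₃ : Setup G.n K s₃ := hs₂.of_eq fun r hr => hf₃ r (Or.inl hr)
  rw [← hm₃] at hv₁
  have h22₃ : s₃.reg 22 = j := by
    rw [hf₃ 22 (by omega), hf₂ 22 (by omega), hf₁ 22 (by omega), h22]
  have hfin : Runs W removeProg s₃ (G.n * 7 + 7) fun s' => Setup G.n K s' ∧ s'.reg 22 = j ∧
      ∃ τ X L, G.View X L s'.mem ∧ EliminationState G.graph A K (j + 1) τ X L := by
    rcases X.eq_empty_or_nonempty with rfl | hne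
    · refine (runs_removeProg_of_not_lt hs₃ (hc₃.empty rfl)).mono (by omega) ?_
      rintro s' rfl
      exact ⟨hs₃, h22₃, τ, _, L, hv₁, hX.skip hj⟩
    · obtain ⟨a, ha, h21, hQ⟩ := hc₃.nonempty hne
      refine (runs_removeProg hs₃ hv₁ h21 hW hW1).mono le_rfl ?_
      rintro s₄ ⟨hv₄, hf₄⟩
      exact ⟨hs₃.of_eq fun r hr => hf₄ r (Or.inl hr), by rw [hf₄ 22 (by omega), h22₃], _, _, _,
        hv₄, hX.remove hj ha fun hcard => hQ (htwin X hcard)⟩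
  refine Runs.seq hfin ?_
  rintro s₄ ⟨hs₄, h22₄, τ', X', L', hv₄, hX₄⟩
  refine Runs.add (j + 1) (by rw [h22₄, hs₄.one]) (by omega)
    ⟨hs₄.of_eq fun r hr => ?_, by simp, τ', X', L', by simpa using hv₄, hX₄⟩
  rw [State.setReg_reg, if_neg (by omega)]

open Classical in
theorem BipGraph.view_inputState (G : BipGraph) :
    G.View (Finset.univ.filter (· ∈ G.left)) (fun _ => 0) G.inputState.mem := by
  have hrow := fun u : Fin G.n => row_add_lt u.2
  refine ⟨fun v => ?_, fun u v => ?_, fun v => ?_⟩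
  · simp only [BipGraph.inputState, Finset.mem_filter, Finset.mem_univ, true_and]
    congr 1
    rw [eq_iff_iff]
    constructor
    · rintro (⟨w, hw, hwl⟩ | ⟨u, w, hw, -⟩)
      · rwa [Fin.ext hw]
      · have := v.2
        omega
    · exact fun h => Or.inl ⟨v, rfl, h⟩
  · simp only [BipGraph.inputState]
    congr 1
    rw [eq_iff_iff]
    constructor
    · rintro (⟨w, hw, hwl⟩ | ⟨u', v', hw, hadj⟩)
      · have := w.2
        omega
      · have huv : (u : ℕ) = u' ∧ (v : ℕ) = v' := by
          have h1 : G.n * u + v = G.n * u' + v' := by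
            have e1 := mul_comm (u : ℕ) G.n
            have e2 := mul_comm (u' : ℕ) G.n
            omega
          have hn : 0 < G.n := by have := v.2; omega
          have h2 := congrArg (· / G.n) h1
          have h3 := congrArg (· % G.n) h1
          simp only [Nat.mul_add_div hn, Nat.div_eq_of_lt v.2, Nat.div_eq_of_lt v'.2,
            Nat.mul_add_mod, Nat.mod_eq_of_lt v.2, Nat.mod_eq_of_lt v'.2] at h2 h3
          exact ⟨by omega, h3⟩
        rwa [Fin.ext huv.1, Fin.ext huv.2]
    · intro h
      exact Or.inr ⟨u, v, by omega, h⟩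
  · simp only [BipGraph.inputState]
    rw [if_neg]
    rintro (⟨w, hw, hwl⟩ | ⟨u', v', hw, hadj⟩)
    · have := w.2
      omega
    · have := hrow u'
      have := v'.2
      omega

open Classical in
/-- The output of the program consists of the fibers of a function that maps every vertex with a
neighbor to the one of its neighbors that is removed last in an elimination. -/
theorem runs_leaderProg {W K : ℕ} {G : BipGraph}
    (htwin : ∀ X : Finset (Fin G.n), 2 ≤ X.card → ∃ a ∈ X, HasTwin G.graph K X a)
    (hW : G.n * G.n + G.n + G.n + G.n ≤ W) (hW1 : K + 1 ≤ W) :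
    Runs W (leaderProg K) G.inputState
      (G.n * (roundTime G.n + 1) + 1 + (G.n * (G.n * 8 + 9) + 4) + 7) fun s =>
      ∃ (τ : Fin G.n → ℕ) (L : Fin G.n → ℕ) (U : ℕ → Prop),
        IsElimination G.graph (Finset.univ.filter (· ∈ G.left)) K τ ∧
        (∀ b, (∃ a ∈ G.left, G.graph.Adj a b) →
          ∃ a ∈ G.left, G.graph.Adj a b ∧ L b = a + 1 ∧
            ∀ a' ∈ G.left, G.graph.Adj a' b → τ a' ≤ τ a) ∧
        (∀ b, (¬ ∃ a ∈ G.left, G.graph.Adj a b) → L b = 0) ∧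
        (∀ a, U a ↔ ∃ b, L b = a + 1) ∧ s.reg 0 = Nat.count U G.n ∧
        (∀ b : Fin G.n, ∀ a < G.n, L b = a + 1 → s.mem b = Nat.count U a) ∧
        ∀ a < G.n, U a → s.mem (G.n + Nat.count U a) = a := by
  rw [leaderProg]
  have h0 : G.inputState.reg 0 = G.n := rfl
  obtain ⟨T, hT⟩ : ∃ T, T = G.n * (roundTime G.n + 1) + 1 + (G.n * (G.n * 8 + 9) + 4) := ⟨_, rfl⟩
  rw [← hT]
  refine Runs.constSeq (by omega) ?_
  refine Runs.constSeq (by omega) ?_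
  refine Runs.mulSeq (G.n * G.n) (by simp [h0]) (by omega) ?_
  refine Runs.addSeq (G.n * G.n + G.n) (by simp [h0]) (by omega) ?_
  refine Runs.addSeq (G.n * G.n + G.n + G.n) (by simp [h0]) (by omega) ?_
  refine Runs.constSeq (by omega) ?_
  refine Runs.constSeq (by omega) ?_
  rw [hT]
  refine Runs.seq (T := G.n * (roundTime G.n + 1) + 1) (T' := G.n * (G.n * 8 + 9) + 4)
    (Runs.loop (N := G.n) (fun j s' => Setup G.n K s' ∧ s'.reg 22 = j ∧
      ∃ τ X L, G.View X L s'.mem ∧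
        EliminationState G.graph (Finset.univ.filter (· ∈ G.left)) K j τ X L) ?_ ?_ ?_) ?_
  · rintro j s ⟨hs, h22, -⟩
    exact ⟨h22, hs.size⟩
  · rintro j s hj ⟨hs, h22, τ, X, L, hv, hX⟩
    exact runs_roundProg hj hs hv h22 hX htwin hW (by omega)
  · exact ⟨⟨by simp [h0], by simp, by simp, by simp, by simp, by simp⟩, by simp, _, _, _,
      by simpa using G.view_inputState, EliminationState.start _ _ _⟩
  · rintro s ⟨hs, -, τ, X, L, hv, hX⟩
    have hX0 : X = ∅ := by
      have := hX.card
      rw [← Finset.card_eq_zero]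
      omega
    subst hX0
    obtain ⟨U, hU⟩ : ∃ U : ℕ → Prop, ∀ a, U a ↔ ∃ b, L b = a + 1 := ⟨_, fun a => Iff.rfl⟩
    refine (runs_outputProg hU hs hv.label hW (by omega)).mono le_rfl ?_
    rintro s' ⟨hcount, hpart, hleader⟩
    refine ⟨τ, L, U, ⟨fun a ha a' ha' => hX.injOn a ha a' ha' (by simp),
      fun a ha => hX.twin a ha (by simp)⟩, fun b hb => ?_, fun b hb => ?_, hU,
      hcount, hpart, hleader⟩
    · rcases hX.label b with ⟨-, h⟩ | ⟨a, ha, -, hab, hL, hmax⟩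
      · obtain ⟨a, ha, hab⟩ := hb
        exact absurd (h a (by simpa using ha) hab) (by simp)
      · exact ⟨a, by simpa using ha, hab, hL,
          fun a' ha' h' => hmax a' (by simpa using ha') h' (by simp)⟩
    · rcases hX.label b with ⟨h, -⟩ | ⟨a, ha, -, hab, hL, hmax⟩
      · exact h
      · exact absurd ⟨a, by simpa using ha, hab⟩ hb

/-! ### The formula that recognizes leaders -/

/-- `x` and `y` are adjacent and have a common color. -/
noncomputable def leaderFormula (m : ℕ) : (bipLang m).Formula (Fin 2) :=
  FirstOrder.Language.Relations.formula₂ (L := bipLang m) (α := Fin 2) BipRel.adj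
    (FirstOrder.Language.Term.var 0) (FirstOrder.Language.Term.var 1) ⊓
  FirstOrder.Language.Formula.iSup fun c : Fin m =>
    FirstOrder.Language.Relations.formula₁ (L := bipLang m) (α := Fin 2) (BipRel.color c)
      (FirstOrder.Language.Term.var 0) ⊓
    FirstOrder.Language.Relations.formula₁ (L := bipLang m) (α := Fin 2) (BipRel.color c)
      (FirstOrder.Language.Term.var 1)

theorem BipGraph.satisfies_leaderFormula (G : BipGraph) {m : ℕ} (M : Fin m → Set (Fin G.n))
    (u v : Fin G.n) :
    G.Satisfies M (leaderFormula m) u v ↔ G.graph.Adj u v ∧ ∃ c, u ∈ M c ∧ v ∈ M c := by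
  let := G.coloring M
  rw [BipGraph.Satisfies, leaderFormula]
  simp only [FirstOrder.Language.Formula.realize_inf, FirstOrder.Language.Formula.realize_iSup,
    FirstOrder.Language.Formula.realize_rel₂, FirstOrder.Language.Formula.realize_rel₁]
  rfl

theorem Nat.exists_count_eq (U : ℕ → Prop) [DecidablePred U] {i n : ℕ} (h : i < Nat.count U n) :
    ∃ a < n, U a ∧ Nat.count U a = i := by
  induction n with
  | zero => simp at h
  | succ n ih =>
    by_cases hi : i < Nat.count U n
    · obtain ⟨a, ha, hUa⟩ := ih hi
      exact ⟨a, ha.trans (Nat.lt_succ_self n), hUa⟩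
    · rw [Nat.count_succ] at h
      split_ifs at h with hU
      · exact ⟨n, Nat.lt_succ_self n, hU, by omega⟩
      · omega

theorem leaderProg_time_le {n K : ℕ} :
    n * (roundTime n + 1) + 1 + (n * (n * 8 + 9) + 4) + 7 ≤ (200 + K) * (n + 1) ^ 4 := by
  have h : n * (roundTime n + 1) + 1 + (n * (n * 8 + 9) + 4) + 7 ≤ 200 * (n + 1) ^ 4 := by
    rw [roundTime]
    ring_nf
    nlinarith [Nat.zero_le n, Nat.zero_le (n ^ 2), Nat.zero_le (n ^ 3), Nat.zero_le (n ^ 4)]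
  exact h.trans (Nat.mul_le_mul_right _ (by omega))

theorem mainTheorem2 (C : Set BipGraph) (hstable : MonadicallyStable C)
    (hlinear : LinearNeighborhoodComplexity C) :
    ∃ (k : ℕ) (prog : RAM.Prog) (c : ℕ) (m : ℕ) (leader : (bipLang m).Formula (Fin 2)),
      ∀ G ∈ C, G.NoIsolated →
        ∃ (p : ℕ) (P : Fin p → Set (Fin G.n)) (ℓ : Fin p → Fin G.n),
          (∃ (t : ℕ) (s : RAM.State),
            RAM.Exec ((G.n + 2) ^ c) prog G.inputState t s ∧ t ≤ c * (G.n + 1) ^ 4 ∧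
              G.IsOutput P ℓ s) ∧
          G.IsRightPartition P ∧
          (∀ i, ℓ i ∈ G.left) ∧
          (∀ i, P i ⊆ G.graph.neighborSet (ℓ i)) ∧
          (∀ v ∈ G.left, {i | (G.graph.neighborSet v ∩ P i).Nonempty}.ncard ≤ k) ∧
          ∃ M : Fin m → Set (Fin G.n), ∀ u ∈ G.left, ∀ v ∈ G.right,
            (G.Satisfies M leader u v ↔ ∃ i, u = ℓ i ∧ v ∈ P i) := by
  classical
  obtain ⟨R, hR⟩ := hstable.exists_not_splits
  obtain ⟨K, hK⟩ := hlinear.exists_traceDist_le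
  set k := splitBound K R with hk
  refine ⟨k, leaderProg K, 200 + K, k + 1, leaderFormula (k + 1), fun G hG hiso => ?_⟩
  have hword : G.n * G.n + G.n + G.n + G.n ≤ (G.n + 2) ^ (200 + K) ∧
      K + 1 ≤ (G.n + 2) ^ (200 + K) := by
    constructor
    · calc G.n * G.n + G.n + G.n + G.n ≤ (G.n + 2) ^ 2 := by nlinarith
        _ ≤ _ := Nat.pow_le_pow_right (by omega) (by omega)
    · calc K + 1 ≤ 2 ^ (200 + K) := by
            have : 200 + K < 2 ^ (200 + K) := Nat.lt_two_pow_self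
            omega
        _ ≤ _ := Nat.pow_le_pow_left (by omega) _
  obtain ⟨t, s, hexec, ht, τ, L, U, hτ, hL, hL0, hU, hcount, hpart, hleader⟩ :=
    runs_leaderProg (G := G) (hK G hG) hword.1 hword.2
  have hnbr : ∀ b ∈ G.right, ∀ a, G.graph.Adj a b → a ∈ G.left := fun b hb a hab =>
    G.isBipartiteWith.symm.mem_of_mem_adj hb hab.symm
  have hleft : ∀ a ∈ G.left, ∀ b, G.graph.Adj a b → b ∈ G.right := fun a ha b hab =>
    G.isBipartiteWith.mem_of_mem_adj ha hab
  have hlead : ∀ b, ∃ a, b ∈ G.right → a ∈ G.left ∧ G.graph.Adj a b ∧ L b = a + 1 ∧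
      ∀ a', G.graph.Adj a' b → τ a' ≤ τ a := by
    intro b
    by_cases hb : b ∈ G.right
    · obtain ⟨a, hab⟩ := hiso b
      obtain ⟨a', ha', hadj, hLb, hmax⟩ := hL b ⟨a, hnbr b hb a hab.symm, hab.symm⟩
      exact ⟨a', fun _ => ⟨ha', hadj, hLb, fun x hx => hmax x (hnbr b hb x hx) hx⟩⟩
    · exact ⟨b, fun h => absurd h hb⟩
  choose lead hlead using hlead
  have hright : ∀ b, L b ≠ 0 → b ∈ G.right := by
    intro b hb
    by_contra h
    refine hb (hL0 b ?_)
    rintro ⟨a, ha, hab⟩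
    exact h (hleft a ha b hab)
  have hUlead : ∀ b ∈ G.right, U (lead b) := fun b hb => (hU _).mpr ⟨b, (hlead b hb).2.2.1⟩
  have hUex : ∀ a, U a → ∃ b ∈ G.right, a = lead b := by
    intro a ha
    obtain ⟨b, hb⟩ := (hU a).mp ha
    have hbr := hright b (by omega)
    refine ⟨b, hbr, ?_⟩
    have := (hlead b hbr).2.2.1
    omega
  -- Vertices of the right side with distinct leaders and a common neighbor are few.
  have hfew : ∀ v ∈ G.left, (lead '' (G.graph.neighborSet v ∩ G.right)).ncard ≤ k := by
    intro v hv
    obtain ⟨D, hD, hbij⟩ := Set.exists_subset_bijOn (G.graph.neighborSet v ∩ G.right) lead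
    rw [← hbij.image_eq, hbij.injOn.ncard_image]
    by_contra! hlt
    have hDfin := Set.toFinite D
    have hmem : ∀ b ∈ hDfin.toFinset, G.graph.Adj v b ∧ b ∈ G.right := by
      intro b hb
      exact hD (hDfin.mem_toFinset.mp hb)
    have hsplit := hτ.splits (lead := lead) (a₀ := v) (by simpa using hv) R hDfin.toFinset
      (fun b hb a hab => by simpa using hnbr b (hmem b hb).2 a hab)
      (fun b hb => ⟨(hlead b (hmem b hb).2).2.1, (hlead b (hmem b hb).2).2.2.2⟩)
      (by rw [hDfin.coe_toFinset]; exact hbij.injOn) (fun b hb => (hmem b hb).1)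
      (by rw [← Set.ncard_eq_toFinset_card D hDfin]; exact hlt.le)
    refine hR G hG hDfin.toFinset (fun b hb => (hmem b hb).2) (hsplit.mono ?_ subset_rfl)
    intro a ha
    simpa using ha
  have hℓ : ∀ i : Fin (Nat.count U G.n), ∃ a : Fin G.n, U a ∧ Nat.count U a = i := by
    intro i
    obtain ⟨a, ha, hUa, hai⟩ := Nat.exists_count_eq U i.2
    exact ⟨⟨a, ha⟩, hUa, hai⟩
  choose ℓ hUℓ hcountℓ using hℓ
  have hℓlead : ∀ b ∈ G.right, ∀ i, lead b = ℓ i ↔ Nat.count U (lead b) = i := by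
    intro b hb i
    refine ⟨fun h => by rw [h, hcountℓ], fun h => Fin.ext ?_⟩
    exact Nat.count_injective (hUlead b hb) (hUℓ i) (h.trans (hcountℓ i).symm)
  have hℓinj : Function.Injective ℓ := by
    intro i j hij
    rw [Fin.ext_iff, ← hcountℓ i, ← hcountℓ j, hij]
  have hindex : ∀ b ∈ G.right, ∃ i, lead b = ℓ i := fun b hb =>
    ⟨⟨_, Nat.count_strict_mono (hUlead b hb) (lead b).2⟩, (hℓlead b hb _).mpr rfl⟩
  have hℓright : ∀ i, ∃ b ∈ G.right, lead b = ℓ i := by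
    intro i
    obtain ⟨b, hb, hbi⟩ := hUex _ (hUℓ i)
    exact ⟨b, hb, Fin.ext hbi.symm⟩
  have hℓleft : ∀ i, ℓ i ∈ G.left := by
    intro i
    obtain ⟨b, hb, hbi⟩ := hℓright i
    rw [← hbi]
    exact (hlead b hb).1
  refine ⟨Nat.count U G.n, fun i => {b | b ∈ G.right ∧ lead b = ℓ i}, ℓ,
    ⟨t, s, hexec, ht.trans leaderProg_time_le, hcount, fun b hb i => ?_,
      fun i => ?_⟩, ⟨fun i => ?_, fun i j hij => ?_, ?_⟩, hℓleft, ?_, fun v hv => ?_, ?_⟩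
  · rw [hpart b (lead b) (lead b).2 (hlead b hb).2.2.1, ← hℓlead b hb]
    exact ⟨fun h => h.2, fun h => ⟨hb, h⟩⟩
  · rw [← hcountℓ i]
    exact hleader _ (ℓ i).2 (hUℓ i)
  · obtain ⟨b, hb, hbi⟩ := hℓright i
    exact ⟨b, hb, hbi⟩
  · refine Set.disjoint_left.mpr fun b hbi hbj => hij (hℓinj ?_)
    exact hbi.2.symm.trans hbj.2
  · ext b
    simp only [Set.mem_iUnion, Set.mem_ofPred_eq]
    refine ⟨fun ⟨_, h, _⟩ => h, fun hb => ?_⟩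
    obtain ⟨i, hi⟩ := hindex b hb
    exact ⟨i, hb, hi⟩
  · rintro i b ⟨hb, hbi⟩
    rw [SimpleGraph.mem_neighborSet, ← hbi]
    exact (hlead b hb).2.1
  · refine (Set.ncard_le_ncard_of_injOn ℓ ?_ hℓinj.injOn (Set.toFinite _)).trans (hfew v hv)
    rintro i ⟨b, hvb, hb, hbi⟩
    exact ⟨b, ⟨hvb, hb⟩, hbi⟩
  · -- The leaders of the neighbors of a vertex are removed after it. Hence the leaders can be
    -- colored such that the color of a part differs from those of the other leaders touching it.
    obtain ⟨col, hcol⟩ := exists_greedy_coloring τ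
      (fun a => {x | x ≠ a ∧ a ∈ G.left ∧ x ∈ lead '' (G.graph.neighborSet a ∩ G.right)}) k
      (by
        rintro a x ⟨hne, ha, b, ⟨hab, hb⟩, rfl⟩
        refine lt_of_le_of_ne ((hlead b hb).2.2.2 a hab) fun e => hne ?_
        exact (hτ.injOn (by simpa using ha) (by simpa using (hlead b hb).1) e).symm)
      (by
        intro a
        by_cases ha : a ∈ G.left
        · exact (Set.ncard_le_ncard (fun x hx => hx.2.2) (Set.toFinite _)).trans (hfew a ha)
        · simp [ha])
    refine ⟨fun c => {x | (∃ i, x = ℓ i ∧ col x = c) ∨ x ∈ G.right ∧ col (lead x) = c},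
      fun u hu v hv => ?_⟩
    rw [G.satisfies_leaderFormula]
    constructor
    · rintro ⟨huv, c, hcu, hcv⟩
      obtain ⟨i, rfl, hci⟩ := hcu.resolve_right fun h => h.1 hu
      have hcv := (hcv.resolve_left (by rintro ⟨j, rfl, -⟩; exact hv (hℓleft j))).2
      refine ⟨i, rfl, hv, ?_⟩
      by_contra hne
      exact hcol _ _ ⟨hne, hu, v, ⟨huv, hv⟩, rfl⟩ (hci.trans hcv.symm)
    · rintro ⟨i, rfl, -, hvi⟩
      refine ⟨?_, col (ℓ i), Or.inl ⟨i, rfl, rfl⟩, Or.inr ⟨hv, by rw [hvi]⟩⟩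
      rw [← hvi]
      exact (hlead v hv).2.1
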